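/- **Conventions.** Let $(K,v)$ be a non-trivially valued algebraically closed field with value group $\Gamma_K$ (written additively, $v(0)=+\infty$), valuation ring $\mathcal O_K$ with maximal ideal $\mathcal M_K$, and let $p$ be the characteristic exponent of $K$ ($p=1$ if $\mathrm{char}\,K=0$, and $p=\mathrm{char}\,K$ otherwise). Let $\mathrm{RV}^*=K^\times/(1+\mathcal M_K)$, $\mathrm{RV}=\mathrm{RV}^*\cup\{0\}$, and let $\mathrm{rv}\colon K\to\mathrm{RV}$ be the quotient map with $\mathrm{rv}(0)=0$. Raising to the power $p$ is bijective on $K$ and on $\mathrm{RV}$, so $x^{n/p^m}$ is well defined on both for $n,m\in\mathbb Z$ and $x\ne0$. Let $\mathcal L$ be a language extending the language $(+,-,\cdot,0,1,\mathrm{div})$ of valued fields, where $\mathrm{div}(x,y)$ means $v(x)\le v(y)$, and let $(K,\mathcal L)$ be an expansion of $(K,v)$ that is *$C$-minimal*: in every $\mathcal L$-structure elementarily equivalent to it, every definable subset of the field is a boolean combination of (open or closed) balls. Definable means definable with parameters; for sets and functions involving $\Gamma_K$ or $\mathrm{RV}^*$ it means interpretable (the preimage in a power of $K$ is definable). A *neighborhood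 of infinity* is a set $\{x\in K: v(x)<\gamma\}$ with $\gamma\in\Gamma_K$; $\lim_{x\to\infty}F(x)=a\in K$ means that for every $\gamma\in\Gamma_K$ there is $\delta\in\Gamma_K$ with $v(F(x)-a)>\gamma$ whenever $v(x)<\delta$. **Theorem ($\mathrm{RV}$-factorization I).** Let $W\subseteq K^k$ be definable and let $f\colon X\subseteq W\times K\to K^\times$ be a definable family of functions such that, for every $w\in W$, the domain $X_w$ of $f_w$ contains a neighborhood of infinity. Let $h\colon Y\subseteq W\times\Gamma_K\to\Gamma_K$ be a definable family which is a $\Gamma$-factorization of $f$ at infinity: for every $w\in W$ there is $\gamma_0\in\Gamma_K$ such that for all $x\in X_w$ with $v(x)<\gamma_0$ one has $v(x)\in Y_w$ and $v(f_w(x))=h_w(v(x))$. Suppose that $h$ is eventually $\mathbb Q$-linear at infinity: there is a finite set $Z\subseteq\mathbb Q$ such that for every $w\in W$ there are $r\in Z$ and $\delta,\alpha\in\Gamma_K$ with $\gamma\in Y_w$ and $h_w(\gamma)=r\gamma+\alpha$ for all $\gamma<\delta$. Then there are a finite partition of $W$ into definable sets $W_1,\dots,W_\ell$, integers $n_1,\dots,n_\ell,m_1,\dots,m_\ell$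 and a definable function $c\colon W\to\mathrm{RV}^*$ such that, for all $i$ and all $w\in W_i$, for all $x$ in a neighborhood of infinity, $$\mathrm{rv}(f_w(x))=\mathrm{rv}(x)^{n_i/p^{m_i}}\,c(w).$$ If in addition * $(K,\mathcal L)$ is definably complete, i.e. every definable family of nested balls whose set of radii tends to $+\infty$ has non-empty intersection, and * every definable function $g\colon\Gamma_K\to\Gamma_K$ is eventually linear, i.e. there are $\delta,\alpha\in\Gamma_K$ and an endomorphism $\lambda$ of the group $(\Gamma_K,+)$ with $g(\gamma)=\lambda(\gamma)+\alpha$ for all $\gamma>\delta$, then for all $i$ and all $w\in W_i$ the limit $$a(w):=\lim_{x\to\infty}\frac{f_w(x)}{x^{n_i/p^{m_i}}}$$ exists in $K$, and $c(w)=\mathrm{rv}(a(w))$. -/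

import Mathlib

open FirstOrder Set

universe uK uF uR uG

/-! ### The language of valued fields -/

/-- Function symbols of the language of valued fields: `+`, `-`, `·`, `0`, `1`. -/
inductive DivFunc : ℕ → Type
  | zero : DivFunc 0
  | one : DivFunc 0
  | add : DivFunc 2
  | sub : DivFunc 2
  | mul : DivFunc 2

/-- The only relation symbol of the language of valued fields: the binary predicate `div`. -/
inductive DivRel : ℕ → Type
  | div : DivRel 2

/-- The language `(+, -, ·, 0, 1, div)` of valued fields. -/
def Ldiv : FirstOrder.Language.{0, 0} := ⟨DivFunc, DivRel⟩

section ValuedField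

variable {K : Type uK} [Field K] {Γ : Type uG} [AddCommGroup Γ] [LinearOrder Γ]
  [IsOrderedAddMonoid Γ]

/-- A valued field as a structure in the language of valued fields; `div(x, y)` holds iff
`v x ≤ v y`. -/
@[reducible] def divStructure (v : AddValuation K (WithTop Γ)) : Ldiv.Structure K where
  funMap := fun {_} s =>
    match s with
    | DivFunc.zero => fun _ => 0
    | DivFunc.one => fun _ => 1
    | DivFunc.add => fun x => x 0 + x 1
    | DivFunc.sub => fun x => x 0 - x 1
    | DivFunc.mul => fun x => x 0 * x 1
  RelMap := fun {_} r =>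
    match r with
    | DivRel.div => fun x => v (x 0) ≤ v (x 1)

/-- The `L`-structure on `K` expands the valued field `(K, v)`, where `L` contains the language of
valued fields through `φ`. -/
def IsValuedFieldExpansion (v : AddValuation K (WithTop Γ)) {L : FirstOrder.Language.{uF, uR}}
    [L.Structure K] (φ : FirstOrder.Language.LHom Ldiv L) : Prop :=
  letI := divStructure v
  φ.IsExpansionOn K

end ValuedField

/-! ### `C`-minimality -/

section CMinimal

variable {L : FirstOrder.Language.{uF, uR}} (φ : FirstOrder.Language.LHom Ldiv L) (M : Type*) [L.Structure M]

/-- `v x ≤ v y`, as expressed by the language of valued fields inside an `L`-structure. -/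
def divRel (x y : M) : Prop := Language.Structure.RelMap (φ.onRelation DivRel.div) ![x, y]

/-- Subtraction, as expressed by the language of valued fields inside an `L`-structure. -/
def divSub (x y : M) : M := Language.Structure.funMap (φ.onFunction DivFunc.sub) ![x, y]

/-- Zero, as expressed by the language of valued fields inside an `L`-structure. -/
def divZero : M := Language.Structure.funMap (φ.onFunction DivFunc.zero) ![]

/-- The balls of a model: closed balls `{x | v (x - a) ≥ v b}` (with `b = 0` for radius `+∞`),
open balls `{x | v (x - a) > v b}` with `b ≠ 0`, and the whole field (radius `-∞`). -/
def modelBalls : Set (Set M) :=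
  {B | (∃ a b : M, B = {x | divRel φ M b (divSub φ M x a)}) ∨
    (∃ a b : M, b ≠ divZero φ M ∧ B = {x | ¬ divRel φ M (divSub φ M x a) b}) ∨
    B = univ}

/-- `K` is `C`-minimal: in every elementarily equivalent structure, every unary set definable with
parameters is a boolean combination of balls.  By the downward Löwenheim–Skolem theorem the universe
in which the elementarily equivalent structures live is large enough to be immaterial. -/
def IsCMinimal (K : Type uK) [L.Structure K] : Prop :=
  ∀ (N : Type (max uK uF uR)) [L.Structure N], (K ≅[L] N) →
    ∀ S : Set N, (univ : Set N).Definable₁ L S → S ∈ BooleanSubalgebra.closure (modelBalls φ N)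

end CMinimal

/-! ### Balls, `RV` and fractional powers -/

section RV

variable {K : Type uK} [Field K] {Γ : Type uG} [AddCommGroup Γ] [LinearOrder Γ]
  [IsOrderedAddMonoid Γ] (v : AddValuation K (WithTop Γ))

/-- `B` is a ball of the given radius in `Γ ∪ {-∞, +∞}`. -/
inductive IsBall : Set K → WithBot (WithTop Γ) → Prop
  | closed (a : K) (γ : WithTop Γ) : IsBall {x | γ ≤ v (x - a)} (γ : WithBot (WithTop Γ))
  | opened (a : K) (γ : Γ) :
      IsBall {x | (γ : WithTop Γ) < v (x - a)} ((γ : WithTop Γ) : WithBot (WithTop Γ))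
  | whole : IsBall univ ⊥

/-- The subgroup `1 + 𝓜` of `Kˣ`. -/
def oneUnits : Subgroup Kˣ where
  carrier := {u | 0 < v ((u : K) - 1)}
  one_mem' := by simp
  mul_mem' := by
    intro a b ha hb
    simp only [Set.mem_ofPred_eq] at ha hb ⊢
    have h1 : 0 ≤ v (a : K) := by
      have := v.map_add ((a : K) - 1) 1
      rw [sub_add_cancel, v.map_one, min_eq_right ha.le] at this
      exact this
    have : ((a * b : Kˣ) : K) - 1 = a * ((b : K) - 1) + ((a : K) - 1) := by push_cast; ring
    rw [this]
    refine v.map_lt_add ?_ ha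
    rw [v.map_mul]
    exact lt_of_lt_of_le hb (le_add_of_nonneg_left h1)
  inv_mem' := by
    intro a ha
    simp only [Set.mem_ofPred_eq] at ha ⊢
    have h0 : v (a : K) = 0 := by
      have := v.map_eq_of_lt_sub (x := 1) (y := (a : K)) (by rw [v.map_one]; exact ha)
      rw [this, v.map_one]
    have h : ((a⁻¹ : Kˣ) : K) - 1 = -((a⁻¹ : Kˣ) : K) * ((a : K) - 1) := by
      have := a.inv_mul
      linear_combination this
    have hinv : v ((a⁻¹ : Kˣ) : K) = 0 := by
      have := congrArg v a.inv_mul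
      rwa [v.map_mul, v.map_one, h0, add_zero] at this
    rw [h, v.map_mul, v.map_neg, hinv, zero_add]
    exact ha

/-- `RV* = Kˣ / (1 + 𝓜)`. -/
def RVStar : Type uK := Kˣ ⧸ oneUnits v

instance : CommGroup (RVStar v) := inferInstanceAs (CommGroup (Kˣ ⧸ oneUnits v))

/-- The quotient map `Kˣ → RV*`. -/
def RVStar.mk : Kˣ →* RVStar v := QuotientGroup.mk' (oneUnits v)

theorem RVStar.mk_surjective : Function.Surjective (RVStar.mk v) :=
  QuotientGroup.mk'_surjective (oneUnits v)

theorem RVStar.mk_eq_one_iff (u : Kˣ) : RVStar.mk v u = 1 ↔ 0 < v ((u : K) - 1) :=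
  QuotientGroup.eq_one_iff u

/-- `RV = RV* ∪ {0}`. -/
abbrev RV : Type uK := WithZero (RVStar v)

open Classical in
/-- The map `rv : K → RV`, sending `0` to `0`. -/
noncomputable def rv (x : K) : RV v :=
  if hx : x = 0 then 0 else (RVStar.mk v (Units.mk0 x hx) : RV v)

/-- `x ^ (n / p ^ m)`, for integers `n` and `m`, where raising to the power `p` is bijective:
`m`-fold extraction of the `p`-th root of `x ^ n` (and `(-m)`-fold raising to the power `p`
when `m < 0`). -/
noncomputable def fracPow {M : Type*} [CommGroupWithZero M] (p : ℕ)
    (hp : Function.Bijective (fun x : M => x ^ p)) (x : M) (n m : ℤ) : M :=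
  ((MulEquiv.ofBijective (powMonoidHom p : M →* M) hp : MulAut M) ^ (-m)) (x ^ n)

/-- In an algebraically closed field with characteristic exponent `p`, raising to the power `p`
is bijective. -/
theorem pow_bijective_field (K : Type uK) [Field K] [IsAlgClosed K] (p : ℕ) [ExpChar K p] :
    Function.Bijective (fun x : K => x ^ p) :=
  ⟨fun _ _ h => frobenius_inj K p h,
    fun y => IsAlgClosed.exists_pow_nat_eq y (expChar_pos K p)⟩

/-- Over an algebraically closed field with characteristic exponent `p`, raising to the power `p`
is bijective on `RV`. -/
theorem pow_bijective_rv [IsAlgClosed K] (p : ℕ) [ExpChar K p] :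
    Function.Bijective (fun x : RV v => x ^ p) := by
  have hp0 : p ≠ 0 := (expChar_pos K p).ne'
  have key : ∀ u : RVStar v, u ^ p = 1 → u = 1 := by
    intro u hu
    obtain ⟨a, rfl⟩ := RVStar.mk_surjective v u
    rw [← map_pow, RVStar.mk_eq_one_iff] at hu
    rw [RVStar.mk_eq_one_iff]
    have h : ((a ^ p : Kˣ) : K) - 1 = ((a : K) - 1) ^ p := by
      rw [sub_pow_expChar, one_pow, Units.val_pow_eq_pow_val]
    rw [h, v.map_pow] at hu
    by_contra hc
    exact absurd hu (not_lt.2 (nsmul_nonpos (not_lt.1 hc) p))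
  constructor
  · intro x y hxy
    simp only at hxy
    induction x using WithZero.recZeroCoe with
    | zero =>
      rw [zero_pow hp0] at hxy
      exact (eq_zero_of_pow_eq_zero hxy.symm).symm
    | coe a =>
      induction y using WithZero.recZeroCoe with
      | zero =>
        rw [zero_pow hp0] at hxy
        exact eq_zero_of_pow_eq_zero hxy
      | coe b =>
        rw [← WithZero.coe_pow, ← WithZero.coe_pow, WithZero.coe_inj] at hxy
        have := key (a / b) (by rw [div_pow, hxy, div_self'])
        rw [div_eq_one.1 this]
  · intro y
    induction y using WithZero.recZeroCoe with
    | zero => exact ⟨0, zero_pow hp0⟩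
    | coe b =>
      obtain ⟨b, rfl⟩ := RVStar.mk_surjective v b
      obtain ⟨z, hz⟩ := IsAlgClosed.exists_pow_nat_eq (b : K) (expChar_pos K p)
      have hz0 : z ≠ 0 := by
        rintro rfl
        rw [zero_pow hp0] at hz
        exact b.ne_zero hz.symm
      refine ⟨(RVStar.mk v (Units.mk0 z hz0) : RV v), ?_⟩
      simp only
      rw [← WithZero.coe_pow, ← map_pow]
      congr 2
      ext
      simpa using hz

end RV

/-! ### Definability in `K`, `Γ` and `RV*` -/

section Definability

variable {K : Type uK} [Field K] {Γ : Type uG} [AddCommGroup Γ] [LinearOrder Γ]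
  [IsOrderedAddMonoid Γ] (v : AddValuation K (WithTop Γ))
  (L : FirstOrder.Language.{uF, uR}) [L.Structure K]

/-- `S ⊆ K^k` is `L`-definable, with parameters. -/
def DefinableK {k : ℕ} (S : Set (Fin k → K)) : Prop :=
  (univ : Set K).Definable L S

/-- `S ⊆ K^k × K^j` is `L`-definable, with parameters. -/
def DefinableKK {k j : ℕ} (S : Set ((Fin k → K) × (Fin j → K))) : Prop :=
  (univ : Set K).Definable L {z : Fin k ⊕ Fin j → K |
    ((fun i => z (Sum.inl i)), (fun i => z (Sum.inr i))) ∈ S}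

/-- `S ⊆ K^k × Γ^j` is definable (interpretable): its preimage in `K^k × (Kˣ)^j` is `L`-definable,
with parameters. -/
def DefinableKΓ {k j : ℕ} (S : Set ((Fin k → K) × (Fin j → Γ))) : Prop :=
  (univ : Set K).Definable L {z : Fin k ⊕ Fin j → K |
    ∃ γ : Fin j → Γ, (∀ i, v (z (Sum.inr i)) = γ i) ∧ ((fun i => z (Sum.inl i)), γ) ∈ S}

/-- `S ⊆ K^k × RV*` is definable (interpretable): its preimage in `K^k × Kˣ` is `L`-definable,
with parameters. -/
def DefinableKRV {k : ℕ} (S : Set ((Fin k → K) × RVStar v)) : Prop :=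
  (univ : Set K).Definable L {z : Fin k ⊕ Fin 1 → K |
    ∃ c : RVStar v, rv v (z (Sum.inr 0)) = (c : RV v) ∧
      ((fun i => z (Sum.inl i)), c) ∈ S}

/-- The function `f : X ⊆ K^k × K → K` is definable: its graph is a definable set. -/
def DefinableFamily {k : ℕ} (X : Set ((Fin k → K) × K)) (f : (Fin k → K) → K → K) : Prop :=
  DefinableKK L {z : (Fin k → K) × (Fin 2 → K) | (z.1, z.2 0) ∈ X ∧ z.2 1 = f z.1 (z.2 0)}

/-- The function `h : Y ⊆ K^k × Γ → Γ` is definable: its graph is a definable set. -/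
def DefinableΓFamily {k : ℕ} (Y : Set ((Fin k → K) × Γ)) (h : (Fin k → K) → Γ → Γ) : Prop :=
  DefinableKΓ v L {z : (Fin k → K) × (Fin 2 → Γ) | (z.1, z.2 0) ∈ Y ∧ z.2 1 = h z.1 (z.2 0)}

/-- The function `c : W ⊆ K^k → RV*` is definable: its graph is a definable set. -/
def DefinableRVMap {k : ℕ} (W : Set (Fin k → K)) (c : (Fin k → K) → RVStar v) : Prop :=
  DefinableKRV v L {z : (Fin k → K) × RVStar v | z.1 ∈ W ∧ z.2 = c z.1}

/-- The unary `Γ`-function `g : Γ → Γ` is definable. -/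
def DefinableΓFun (g : Γ → Γ) : Prop :=
  DefinableΓFamily v L (univ : Set ((Fin 0 → K) × Γ)) (fun _ => g)

/-- `(K, L)` is definably complete: every definable family `(B_t)_{t ∈ T}` of nested balls whose
set of radii tends to `+∞` has non-empty intersection. -/
def IsDefinablyComplete : Prop :=
  ∀ (k : ℕ) (T : Set (Fin k → K)) (B : (Fin k → K) → Set K),
    DefinableK L T →
    DefinableKK L {z : (Fin k → K) × (Fin 1 → K) | z.1 ∈ T ∧ z.2 0 ∈ B z.1} →
    (∀ t ∈ T, ∃ r, IsBall v (B t) r) →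
    (∀ s ∈ T, ∀ t ∈ T, B s ⊆ B t ∨ B t ⊆ B s) →
    (∀ γ : Γ, ∃ t ∈ T, ∃ r, IsBall v (B t) r ∧ ((γ : WithTop Γ) : WithBot (WithTop Γ)) < r) →
    (⋂ t ∈ T, B t).Nonempty

end Definability

/-! ### Behaviour near infinity -/

section Infinity

variable {K : Type uK} [Field K] {Γ : Type uG} [AddCommGroup Γ] [LinearOrder Γ]
  [IsOrderedAddMonoid Γ] (v : AddValuation K (WithTop Γ))

/-- `P` holds in a neighborhood of infinity, that is, on `K ∖ B(0, γ) = {x | v x < γ}` for some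
`γ ∈ Γ`. -/
def NearInfinity (P : K → Prop) : Prop := ∃ γ : Γ, ∀ x : K, v x < γ → P x

/-- `f : X ⊆ K → K` factorizes at infinity over `Γ` through `h : Y ⊆ Γ → Γ`. -/
def FactorizesAtInfinity (X : Set K) (f : K → K) (Y : Set Γ) (h : Γ → Γ) : Prop :=
  ∃ γ₀ : Γ, ∀ x ∈ X, v x < γ₀ → ∃ γ ∈ Y, v x = γ ∧ v (f x) = h γ

/-- `lim_{x → ∞} F(x) = a`. -/
def HasLimitAtInfinity (F : K → K) (a : K) : Prop :=
  ∀ γ : Γ, ∃ δ : Γ, ∀ x : K, v x < δ → (γ : WithTop Γ) < v (F x - a)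

/-- `g : Γ → Γ` is eventually linear. -/
def EventuallyLinear (g : Γ → Γ) : Prop :=
  ∃ (δ α : Γ) (lam : Γ →+ Γ), ∀ γ : Γ, δ < γ → g γ = lam γ + α

/-- The family `h : Y ⊆ W × Γ → Γ` is eventually `ℚ`-linear towards `-∞` (the values `v x` of the
points `x` near infinity), with finitely many slopes: each `h_w` is of the form
`γ ↦ r γ + α` for all sufficiently small `γ`, with `r` in a finite set independent of `w`.
The equation `h_w(γ) = r γ + α` is written with denominators cleared. -/
def EventuallyQLinearAtInfinity {P : Type*} (W : Set P) (Y : Set (P × Γ)) (h : P → Γ → Γ) : Prop :=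
  ∃ Z : Finset ℚ, ∀ w ∈ W, ∃ r ∈ Z, ∃ δ α : Γ, ∀ γ : Γ, γ < δ →
    (w, γ) ∈ Y ∧ r.den • (h w γ - α) = r.num • γ

end Infinity

/-! A slope $a/b$ makes $f_w(x)^b/x^a$ have constant valuation near infinity. After rescaling it
maps into the residue field, where definable maps are eventually constant
(`eventually_residue_const`). This yields `exists_leading_coefficient`:
$\mathrm{rv}(f_w(x))^b=\mathrm{rv}(x)^a\,\mathrm{rv}(c)^b$. Extracting the $b$-th root is legitimate
in RV once $b$ is a power of $p$, and this is the main point (`exists_den_eq_pow`).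

If a prime $q\ne p$ divides $b$, put $y(z)=f(z^q)^{b/q}/z^a$. Its valuation is constant near
infinity, while $y(\zeta z)=\zeta^{-a}y(z)$ for a primitive $q$-th root of unity $\zeta$, with
$\zeta^a\ne1$. Residues do not suffice for a contradiction, since $\zeta$ may be $1$ modulo the
maximal ideal in mixed characteristic. What is needed is that bounded definable functions converge
at infinity up to every precision (`exists_eventually_le_sub`). If they did not, the endpoint of the
set of attainable precisions would produce a definable $H$ whose valuation tends to $0$ through
positive values, which `not_tendsto_zero_from_above` excludes.

$C$-minimality enters through an ultrapower: the members of a definable family are controlled by a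
bounded number of balls. Hence definable families of subsets of the residue field are uniformly
finite or cofinite, definable initial segments of values have endpoints, and a definable map from
values to residues has finite image (`finite_residues_of_valuation_invariant`). Together these show
that a function invariant under each unit, modulo a suitable equivalence relation whose classes are
balls, is eventually constant (`eventually_const_of_unit_invariant`).

Convergence up to every precision also gives the limit: the approximations to $f_w(x)/x^{n/p^m}$
form nested closed balls with radii tending to $+\infty$, and definable completeness supplies a
common point. -/

/-! ### A calculus of definable predicates and maps -/

/-- `X` is identified with a finite cartesian power of `K`. -/
class CartesianPower (K : Type uK) (X : Type uK) where
  index : Type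
  finite_index : Finite index
  equiv : X ≃ (index → K)

namespace CartesianPower

variable (K : Type uK)

instance : CartesianPower K K := ⟨Unit, inferInstance, (Equiv.funUnique Unit K).symm⟩

instance (ι : Type) [Finite ι] : CartesianPower K (ι → K) := ⟨ι, inferInstance, Equiv.refl _⟩

instance (X Y : Type uK) [CartesianPower K X] [CartesianPower K Y] : CartesianPower K (X × Y) :=
  ⟨index K X ⊕ index K Y, haveI := finite_index (K := K) (X := X)
    haveI := finite_index (K := K) (X := Y); inferInstance,
    (Equiv.prodCongr equiv equiv).trans (Equiv.sumArrowEquivProdArrow _ _ _).symm⟩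

instance (X : Type uK) [CartesianPower K X] : Finite (index K X) := finite_index

end CartesianPower

section Calculus

open CartesianPower

variable {L : FirstOrder.Language.{uF, uR}} {K : Type uK} [L.Structure K]
variable {X Y Z : Type uK} [CartesianPower K X] [CartesianPower K Y] [CartesianPower K Z]

variable (L K) in
/-- A predicate on a cartesian power of `K` is definable with parameters. -/
def DefPred (P : X → Prop) : Prop :=
  (univ : Set K).Definable L {z : index K X → K | P (equiv.symm z)}

variable (L K) in
/-- A map between cartesian powers of `K` is definable with parameters. -/
@[fun_prop]
def DefMap (f : X → Y) : Prop :=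
  ∀ i, (univ : Set K).DefinableFun L fun z : index K X → K => equiv (K := K) (f (equiv.symm z)) i

namespace DefMap

@[fun_prop]
theorem id : DefMap L K fun x : X => x := fun i => by
  simpa using Set.DefinableFun.proj L

@[fun_prop]
theorem const (y : Y) : DefMap L K fun _ : X => y := fun _ =>
  L.definableFun_const _ (mem_univ _)

@[fun_prop]
theorem comp {g : Y → Z} {f : X → Y} (hg : DefMap L K g) (hf : DefMap L K f) :
    DefMap L K fun x => g (f x) := fun i => by
  simpa using Set.DefinableFun.comp (g := fun z => equiv (K := K) (f (equiv.symm z))) hf (hg i)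

@[fun_prop]
theorem fst : DefMap L K (Prod.fst : X × Y → X) := fun i =>
  show (univ : Set K).DefinableFun L fun z => (equiv (K := K) ((equiv (K := K)).symm _)) i by
    simp only [Equiv.apply_symm_apply]
    exact Set.DefinableFun.proj L (i := Sum.inl i)

@[fun_prop]
theorem snd : DefMap L K (Prod.snd : X × Y → Y) := fun i =>
  show (univ : Set K).DefinableFun L fun z => (equiv (K := K) ((equiv (K := K)).symm _)) i by
    simp only [Equiv.apply_symm_apply]
    exact Set.DefinableFun.proj L (i := Sum.inr i)

@[fun_prop]
theorem prodMk {f : X → Y} {g : X → Z} (hf : DefMap L K f) (hg : DefMap L K g) :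
    DefMap L K fun x => (f x, g x) := fun i =>
  match i with
  | Sum.inl i => hf i
  | Sum.inr i => hg i

@[fun_prop]
theorem apply {ι : Type} [Finite ι] (i : ι) : DefMap L K fun x : ι → K => x i := fun _ =>
  Set.DefinableFun.proj L (i := i)

theorem pi {ι : Type} [Finite ι] {f : X → ι → K} (hf : ∀ i, DefMap L K fun x => f x i) :
    DefMap L K f := fun i => hf i ()

end DefMap

namespace DefPred

variable {P Q : X → Prop}

theorem and (hP : DefPred L K P) (hQ : DefPred L K Q) : DefPred L K fun x => P x ∧ Q x :=
  hP.inter hQ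

theorem or (hP : DefPred L K P) (hQ : DefPred L K Q) : DefPred L K fun x => P x ∨ Q x :=
  hP.union hQ

theorem not (hP : DefPred L K P) : DefPred L K fun x => ¬ P x :=
  hP.compl

theorem congr (hP : DefPred L K P) (h : ∀ x, Q x ↔ P x) : DefPred L K Q := by
  rwa [show Q = P from funext fun x => propext (h x)]

theorem imp (hP : DefPred L K P) (hQ : DefPred L K Q) : DefPred L K fun x => P x → Q x :=
  (hP.not.or hQ).congr fun _ => imp_iff_not_or

theorem comp {P : Y → Prop} {f : X → Y} (hP : DefPred L K P) (hf : DefMap L K f) :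
    DefPred L K fun x => P (f x) := by
  have := Set.Definable.preimage_map
    (F := fun z : index K X → K => equiv (K := K) (f (equiv.symm z))) hf hP
  simpa [DefPred, Set.preimage] using this

theorem comp₂ {P : Y → Z → Prop} (hP : DefPred L K fun q : Y × Z => P q.1 q.2)
    {f : X → Y} {g : X → Z} (hf : DefMap L K f) (hg : DefMap L K g) :
    DefPred L K fun x => P (f x) (g x) :=
  hP.comp (hf.prodMk hg)

theorem ex {P : X → Y → Prop} (hP : DefPred L K fun q : X × Y => P q.1 q.2) :
    DefPred L K fun x => ∃ y, P x y := by
  have := Set.Definable.exists_of_finite (α := index K X) (β := index K Y) hP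
  unfold DefPred
  convert this using 1
  ext z
  simp only [Set.mem_ofPred_eq]
  exact (equiv (K := K) (X := Y)).exists_congr_left.trans Iff.rfl

theorem all {P : X → Y → Prop} (hP : DefPred L K fun q : X × Y => P q.1 q.2) :
    DefPred L K fun x => ∀ y, P x y :=
  (ex (P := fun x y => ¬ P x y) hP.not).not.congr fun _ => by simp

theorem eq {f g : X → K} (hf : DefMap L K f) (hg : DefMap L K g) :
    DefPred L K fun x => f x = g x :=
  Set.DefinableFun.ofPred_eq (hf ()) (hg ())

theorem finite_ex {ι : Type*} [Finite ι] {P : ι → X → Prop} (hP : ∀ i, DefPred L K (P i)) :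
    DefPred L K fun x => ∃ i, P i x := by
  have := Set.definable_iUnion_of_finite hP
  simpa [DefPred, Set.iUnion_ofPred] using this

end DefPred

/-- A map with definable graph is definable. -/
theorem DefMap.of_graph {f : X → K} (h : DefPred L K fun q : X × K => q.2 = f q.1) :
    DefMap L K f := fun i => by
  have := h.preimage_comp (fun j : index K X ⊕ Unit => Sum.elim some (fun _ => none) j)
  unfold Set.DefinableFun Function.tupleGraph
  convert this using 1
  ext z
  simp only [Set.mem_ofPred_eq, Set.mem_preimage]
  exact eq_comm

end Calculus

/-! ### Uniform bounds from `C`-minimality -/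

section Uniform

open CartesianPower

variable {L : FirstOrder.Language.{uF, uR}} (φ : FirstOrder.Language.LHom Ldiv L)

/-- Membership in `S` only depends on the position of a point with respect to the balls whose
centres and radii are listed in `l`. -/
def ModelTame {M : Type*} [L.Structure M] (l : List (M × M)) (S : Set M) : Prop :=
  ∀ x y, (∀ q ∈ l,
    (divRel φ M q.2 (divSub φ M x q.1) ↔ divRel φ M q.2 (divSub φ M y q.1)) ∧
    (divRel φ M (divSub φ M x q.1) q.2 ↔ divRel φ M (divSub φ M y q.1) q.2)) → (x ∈ S ↔ y ∈ S)

/-- One pair (centre, radius) records the position relative to both the closed and the open ball, so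
complements keep the list and unions concatenate two lists. -/
theorem exists_modelTame {M : Type*} [L.Structure M] {S : Set M}
    (hS : S ∈ BooleanSubalgebra.closure (modelBalls φ M)) :
    ∃ l : List (M × M), ModelTame φ l S := by
  induction hS using BooleanSubalgebra.closure_bot_sup_induction with
  | mem S hS =>
    rcases hS with ⟨a, b, rfl⟩ | ⟨a, b, -, rfl⟩ | rfl
    · exact ⟨[(a, b)], fun x y h => (h (a, b) (by simp)).1⟩
    · exact ⟨[(a, b)], fun x y h => not_congr (h (a, b) (by simp)).2⟩
    · exact ⟨[], fun x y _ => by simp⟩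
  | bot => exact ⟨[], fun x y _ => by simp⟩
  | sup S _ T _ hS hT =>
    obtain ⟨l, hl⟩ := hS
    obtain ⟨l', hl'⟩ := hT
    refine ⟨l ++ l', fun x y h => or_congr (hl x y fun q hq => h q ?_)
      (hl' x y fun q hq => h q ?_)⟩ <;> simp [hq]
  | compl S _ hS =>
    obtain ⟨l, hl⟩ := hS
    exact ⟨l, fun x y h => not_congr (hl x y h)⟩

variable {K : Type uK} [L.Structure K]

variable (K) in
/-- A countable ultrapower of `K`. -/
abbrev Ultrapower : Type uK := ((Filter.hyperfilter ℕ : Ultrafilter ℕ) : Filter ℕ).Product fun _ => K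

theorem elementarilyEquivalent_ultrapower [Nonempty K] : K ≅[L] Ultrapower K :=
  Language.elementarilyEquivalent_iff.2 fun ψ => by
    rw [Language.Ultraproduct.sentence_realize]
    simp

/-- The formula stating `v (x 0) ≤ v (x 1 - x 2)`. -/
def divSubFormula : L.Formula (Fin 3) :=
  (φ.onRelation DivRel.div).formula₂ (Language.Term.var 0)
    ((φ.onFunction DivFunc.sub).apply₂ (Language.Term.var 1) (Language.Term.var 2))

/-- The formula stating `v (x 1 - x 2) ≤ v (x 0)`. -/
def subDivFormula : L.Formula (Fin 3) :=
  (φ.onRelation DivRel.div).formula₂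
    ((φ.onFunction DivFunc.sub).apply₂ (Language.Term.var 1) (Language.Term.var 2))
    (Language.Term.var 0)

theorem realize_divSubFormula {M : Type*} [L.Structure M] (x : Fin 3 → M) :
    (divSubFormula φ).Realize x ↔ divRel φ M (x 0) (divSub φ M (x 1) (x 2)) := by
  simp [divSubFormula, divRel, divSub, Language.Formula.realize_rel₂,
    Language.Term.realize_functions_apply₂]

theorem realize_subDivFormula {M : Type*} [L.Structure M] (x : Fin 3 → M) :
    (subDivFormula φ).Realize x ↔ divRel φ M (divSub φ M (x 1) (x 2)) (x 0) := by
  simp [subDivFormula, divRel, divSub, Language.Formula.realize_rel₂,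
    Language.Term.realize_functions_apply₂]

theorem ModelTame.of_equiv {M N : Type*} [L.Structure M] [L.Structure N] (g : M ≃[L] N)
    {l : List (N × N)} {S : Set N} (h : ModelTame φ l S) :
    ModelTame φ (l.map fun q => (g.symm q.1, g.symm q.2)) {x | g x ∈ S} := by
  intro x y hxy
  refine h (g x) (g y) fun q hq => ?_
  have := hxy (g.symm q.1, g.symm q.2) (List.mem_map.2 ⟨q, hq, rfl⟩)
  have h1 : ∀ z : M, divRel φ N q.2 (divSub φ N (g z) q.1) ↔
      divRel φ M (g.symm q.2) (divSub φ M z (g.symm q.1)) := fun z => by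
    have := Language.StrongHomClass.realize_formula g (divSubFormula φ) (v := ![g.symm q.2, z, g.symm q.1])
    rw [realize_divSubFormula, realize_divSubFormula] at this
    simpa using this
  have h2 : ∀ z : M, divRel φ N (divSub φ N (g z) q.1) q.2 ↔
      divRel φ M (divSub φ M z (g.symm q.1)) (g.symm q.2) := fun z => by
    have := Language.StrongHomClass.realize_formula g (subDivFormula φ) (v := ![g.symm q.2, z, g.symm q.1])
    rw [realize_subDivFormula, realize_subDivFormula] at this
    simpa using this
  rw [h1, h1, h2, h2]
  exact this

/-- $C$-minimality speaks of structures in one fixed universe. A copy of `U` is placed there by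
`ULift`, and the balls found are carried back along the isomorphism. -/
theorem IsCMinimal.exists_modelTame_of_elementarilyEquivalent (hC : IsCMinimal φ K)
    {U : Type uK} [L.Structure U] (hU : K ≅[L] U) {S : Set U}
    (hS : (univ : Set U).Definable₁ L S) : ∃ l : List (U × U), ModelTame φ l S := by
  let e : U ≃ ULift.{max uF uR} U := Equiv.ulift.symm
  let _ : L.Structure (ULift.{max uF uR} U) := e.inducedStructure
  let g : U ≃[L] ULift.{max uF uR} U := e.inducedStructureEquiv
  have hge : ∀ x, g x = e x := fun x => rfl
  have hdef : (univ : Set (ULift.{max uF uR} U)).Definable₁ L {y | e.symm y ∈ S} := by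
    obtain ⟨ψ, hψ⟩ := Set.definable_iff_exists_formula_sum.1 hS
    refine Set.definable_iff_exists_formula_sum.2
      ⟨ψ.relabel (Sum.map (fun a => ⟨e a.1, mem_univ _⟩) id), ?_⟩
    ext x
    have h1 := Set.ext_iff.1 hψ fun i => e.symm (x i)
    simp only [Set.mem_ofPred_eq] at h1 ⊢
    rw [h1, Language.Formula.realize_relabel, ← Language.StrongHomClass.realize_formula g]
    refine iff_of_eq (congrArg ψ.Realize (funext fun i => ?_))
    rcases i with i | i
    · rfl
    · rfl
  obtain ⟨l, hl⟩ := exists_modelTame φ (hC _ (hU.trans (Language.StrongHomClass.elementarilyEquivalent g)) _ hdef)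
  exact ⟨_, hl.of_equiv φ g⟩

/-- In a definable family, all members are boolean combinations of a bounded number of balls. -/
theorem IsCMinimal.exists_uniform_modelTame [Nonempty K] (hC : IsCMinimal φ K) {X : Type uK}
    [CartesianPower K X] {P : X → K → Prop} (hP : DefPred L K fun q : X × K => P q.1 q.2) :
    ∃ N : ℕ, ∀ t, ∃ l : List (K × K), l.length ≤ N ∧ ModelTame φ l {a | P t a} := by
  by_contra! hcon
  -- The fibre over `t n` needs more than `n` balls. The class of this sequence in the ultrapower
  -- defines a single unary set, to which $C$-minimality applies.
  choose t ht using hcon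
  obtain ⟨ψ, hψ⟩ := Set.definable_iff_exists_formula_sum.1 hP
  have hψ' : ∀ t a, P t a ↔ ψ.Realize (Sum.elim (↑) (Sum.elim (equiv (K := K) t) fun _ => a)) := by
    intro t a
    have := Set.ext_iff.1 hψ (Sum.elim (equiv (K := K) t) fun _ => a)
    rw [Set.mem_ofPred_eq, Set.mem_ofPred_eq] at this
    rw [← this]
    exact iff_of_eq (congrArg₂ P ((equiv (K := K)).symm_apply_apply t).symm rfl)
  let co : (ℕ → K) → Ultrapower K := fun x => x
  let par : (univ : Set K) ⊕ index K X → ℕ → K :=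
    Sum.elim (fun a _ => a) fun i n => equiv (K := K) (t n) i
  let S : Set (Ultrapower K) := {x | ψ.Realize
    (Sum.elim (fun a => co (par (Sum.inl a))) (Sum.elim (fun i => co (par (Sum.inr i))) fun _ => x))}
  have hS : (univ : Set (Ultrapower K)).Definable₁ L S := by
    refine Set.definable_iff_exists_formula_sum.2 ⟨ψ.relabel (Sum.elim
      (fun a => Sum.inl ⟨co (par (Sum.inl a)), mem_univ _⟩)
      (Sum.elim (fun i => Sum.inl ⟨co (par (Sum.inr i)), mem_univ _⟩) fun _ => Sum.inr 0)), ?_⟩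
    ext x
    simp only [S, Set.mem_ofPred_eq, Language.Formula.realize_relabel]
    refine iff_of_eq (congrArg ψ.Realize (funext fun i => ?_))
    rcases i with i | i | i <;> rfl
  have hmem : ∀ x : ℕ → K, co x ∈ S ↔
      ∀ᶠ n in (Filter.hyperfilter ℕ : Ultrafilter ℕ), P (t n) (x n) := by
    intro x
    have := Language.Ultraproduct.realize_formula_cast (u := Filter.hyperfilter ℕ) ψ
      (Sum.elim (fun a => par (Sum.inl a)) (Sum.elim (fun i => par (Sum.inr i)) fun _ => x))
    simp only [hψ']
    refine Iff.trans (iff_of_eq (congrArg ψ.Realize (funext fun i => ?_))) (this.trans (iff_of_eq ?_))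
    · rcases i with i | i | i <;> rfl
    · congr 1
      ext n
      refine iff_of_eq (congrArg ψ.Realize (funext fun i => ?_))
      rcases i with i | i | i <;> rfl
  obtain ⟨l, hl⟩ := hC.exists_modelTame_of_elementarilyEquivalent φ
    (elementarilyEquivalent_ultrapower (L := L) (K := K)) hS
  have hrep : ∀ x : Ultrapower K, ∃ r : ℕ → K, co r = x := fun x => Quotient.exists_rep x
  choose rep hrep using hrep
  -- The list from the ultrapower is read coordinatewise through representatives. Once `n` reaches
  -- its length it is too short for `t n`, hence fails to determine that fibre; for smaller `n` the
  -- choice is irrelevant.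
  have hbad : ∀ n, ∃ x y : K, l.length ≤ n → (∀ q ∈ l,
      (divRel φ K (rep q.2 n) (divSub φ K x (rep q.1 n)) ↔
        divRel φ K (rep q.2 n) (divSub φ K y (rep q.1 n))) ∧
      (divRel φ K (divSub φ K x (rep q.1 n)) (rep q.2 n) ↔
        divRel φ K (divSub φ K y (rep q.1 n)) (rep q.2 n))) ∧ ¬ (P (t n) x ↔ P (t n) y) := by
    intro n
    by_cases hn : l.length ≤ n
    · have := ht n (l.map fun q => (rep q.1 n, rep q.2 n)) (by simpa using hn)
      unfold ModelTame at this
      push Not at this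
      obtain ⟨x, y, hxy, hne⟩ := this
      refine ⟨x, y, fun _ => ⟨fun q hq => hxy _ (List.mem_map.2 ⟨q, hq, rfl⟩), ?_⟩⟩
      simp only [Set.mem_ofPred_eq] at hne
      tauto
    · obtain ⟨x⟩ := ‹Nonempty K›
      exact ⟨x, x, fun h => absurd h hn⟩
  choose x y hxy using hbad
  have hlarge : ∀ᶠ n in (Filter.hyperfilter ℕ : Filter ℕ), l.length ≤ n :=
    Nat.hyperfilter_le_atTop (Filter.eventually_ge_atTop _)
  have key : co x ∈ S ↔ co y ∈ S := by
    refine hl (co x) (co y) fun q hq => ?_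
    have h1 : ∀ z : ℕ → K, divRel φ (Ultrapower K) q.2 (divSub φ _ (co z) q.1) ↔
        ∀ᶠ n in (Filter.hyperfilter ℕ : Ultrafilter ℕ),
          divRel φ K (rep q.2 n) (divSub φ K (z n) (rep q.1 n)) := fun z => by
      have := Language.Ultraproduct.realize_formula_cast (u := Filter.hyperfilter ℕ)
        (divSubFormula φ) ![rep q.2, z, rep q.1]
      simp only [realize_divSubFormula] at this
      nth_rewrite 1 [← hrep q.2, ← hrep q.1]
      exact this
    have h2 : ∀ z : ℕ → K, divRel φ (Ultrapower K) (divSub φ _ (co z) q.1) q.2 ↔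
        ∀ᶠ n in (Filter.hyperfilter ℕ : Ultrafilter ℕ),
          divRel φ K (divSub φ K (z n) (rep q.1 n)) (rep q.2 n) := fun z => by
      have := Language.Ultraproduct.realize_formula_cast (u := Filter.hyperfilter ℕ)
        (subDivFormula φ) ![rep q.2, z, rep q.1]
      simp only [realize_subDivFormula] at this
      nth_rewrite 1 [← hrep q.2, ← hrep q.1]
      exact this
    rw [h1, h1, h2, h2]
    constructor <;> refine Filter.eventually_congr ?_ <;> filter_upwards [hlarge] with n hn
    · exact ((hxy n hn).1 q hq).1
    · exact ((hxy n hn).1 q hq).2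
  rw [hmem, hmem] at key
  obtain ⟨n, hn⟩ := (hlarge.and (show ∀ᶠ n in (Filter.hyperfilter ℕ : Ultrafilter ℕ),
      (P (t n) (x n) ↔ P (t n) (y n)) by
    by_cases hx : ∀ᶠ n in (Filter.hyperfilter ℕ : Ultrafilter ℕ), P (t n) (x n)
    · filter_upwards [hx, key.1 hx] with n h h' using iff_of_true h h'
    · have hy := mt key.2 hx
      rw [← Ultrafilter.eventually_not] at hx hy
      filter_upwards [hx, hy] with n h h' using iff_of_false h h')).exists
  exact (hxy n hn.1).2 hn.2

end Uniform

/-! ### Definable valued fields -/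

section DefinableField

open CartesianPower

variable (L : FirstOrder.Language.{uF, uR}) (K : Type uK) [L.Structure K] [Field K]

/-- Subtraction and multiplication of `K` are definable. -/
class DefinableField : Prop where
  sub : DefMap L K fun q : K × K => q.1 - q.2
  mul : DefMap L K fun q : K × K => q.1 * q.2

variable {L K} [DefinableField L K] {X : Type uK} [CartesianPower K X]

namespace DefMap

variable {f g : X → K}

@[fun_prop]
theorem sub (hf : DefMap L K f) (hg : DefMap L K g) : DefMap L K fun x => f x - g x :=
  DefinableField.sub.comp (hf.prodMk hg)

@[fun_prop]
theorem mul (hf : DefMap L K f) (hg : DefMap L K g) : DefMap L K fun x => f x * g x :=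
  DefinableField.mul.comp (hf.prodMk hg)

@[fun_prop]
theorem inv (hf : DefMap L K f) : DefMap L K fun x => (f x)⁻¹ := by
  have h : DefMap L K fun x : K => x⁻¹ := by
    refine DefMap.of_graph (((DefPred.eq (f := fun q : K × K => q.1) (g := fun _ => 0)
      (by fun_prop) (by fun_prop)).and (DefPred.eq (f := fun q : K × K => q.2) (g := fun _ => 0)
      (by fun_prop) (by fun_prop))).or (DefPred.eq (f := fun q : K × K => q.1 * q.2)
      (g := fun _ => 1) (by fun_prop) (by fun_prop)) |>.congr fun q => ?_)
    by_cases h : q.1 = 0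
    · simp [h]
    · simp only [h, false_and, false_or]
      exact ⟨fun e => e ▸ mul_inv_cancel₀ h, eq_inv_of_mul_eq_one_right⟩
  exact h.comp hf

@[fun_prop]
theorem div (hf : DefMap L K f) (hg : DefMap L K g) : DefMap L K fun x => f x / g x := by
  simp only [div_eq_mul_inv]
  fun_prop

@[fun_prop]
theorem pow (hf : DefMap L K f) (n : ℕ) : DefMap L K fun x => f x ^ n := by
  induction n with
  | zero => simpa using DefMap.const 1
  | succ n ih => simpa only [pow_succ] using ih.mul hf

@[fun_prop]
theorem zpow (hf : DefMap L K f) (n : ℤ) : DefMap L K fun x => f x ^ n := by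
  cases n with
  | ofNat n => simpa using hf.pow n
  | negSucc n => simpa only [zpow_negSucc] using (hf.pow (n + 1)).inv

end DefMap

end DefinableField

/-! ### The filter of neighborhoods of infinity -/

section Valued

variable {K : Type uK} [Field K] {Γ : Type uG} [AddCommGroup Γ] [LinearOrder Γ]
  [IsOrderedAddMonoid Γ] (v : AddValuation K (WithTop Γ))

/-- The filter of neighborhoods of infinity. -/
def infFilter : Filter K := ⨅ γ : Γ, Filter.principal {x | v x < γ}

variable {v}

theorem eventually_infFilter {P : K → Prop} :
    (∀ᶠ x in infFilter v, P x) ↔ NearInfinity v P := by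
  unfold infFilter NearInfinity
  rw [Filter.Eventually, Filter.mem_iInf_of_directed]
  · simp [Set.subset_def]
  · intro γ δ
    refine ⟨min γ δ, Filter.principal_mono.2 fun x hx => ?_,
      Filter.principal_mono.2 fun x hx => ?_⟩ <;>
      simp only [Set.mem_ofPred_eq, WithTop.coe_min, lt_min_iff] at hx ⊢
    exacts [hx.1, hx.2]

theorem eventually_lt_coe (γ : Γ) : ∀ᶠ x in infFilter v, v x < γ :=
  eventually_infFilter.2 ⟨γ, fun _ => id⟩

theorem AddValuation.ne_top {c : K} (hc : c ≠ 0) : v c ≠ ⊤ := mt v.top_iff.1 hc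

theorem AddValuation.exists_coe {c : K} (hc : c ≠ 0) : ∃ γ : Γ, v c = γ :=
  ⟨(v c).untop (v.ne_top hc), by simp⟩

theorem AddValuation.ne_zero_of_lt {x : K} {y : WithTop Γ} (h : v x < y) : x ≠ 0 := by
  rintro rfl
  simp at h

theorem AddValuation.ne_zero_of_eq {x : K} (h : v x = 0) : x ≠ 0 := by
  rintro rfl
  simp at h

theorem AddValuation.mul_le_mul_iff {c a b : K} (hc : c ≠ 0) :
    v (c * a) ≤ v (c * b) ↔ v a ≤ v b := by
  rw [v.map_mul, v.map_mul]
  exact WithTop.add_le_add_iff_left (v.ne_top hc)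

theorem AddValuation.mul_lt_mul_iff {c a b : K} (hc : c ≠ 0) :
    v (c * a) < v (c * b) ↔ v a < v b :=
  lt_iff_lt_of_le_iff_le (v.mul_le_mul_iff hc)

theorem AddValuation.mul_eq_mul_iff {c a b : K} (hc : c ≠ 0) :
    v (c * a) = v (c * b) ↔ v a = v b := by
  simp only [le_antisymm_iff, v.mul_le_mul_iff hc]

theorem AddValuation.div_nonneg_iff {c a : K} (hc : c ≠ 0) : 0 ≤ v (a / c) ↔ v c ≤ v a := by
  have := v.mul_le_mul_iff (a := 1) (b := a / c) hc
  rw [mul_one, mul_div_cancel₀ _ hc, v.map_one] at this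
  exact this.symm

theorem AddValuation.div_pos_iff {c a : K} (hc : c ≠ 0) : 0 < v (a / c) ↔ v c < v a := by
  have := v.mul_lt_mul_iff (a := 1) (b := a / c) hc
  rw [mul_one, mul_div_cancel₀ _ hc, v.map_one] at this
  exact this.symm

theorem AddValuation.div_eq_zero_iff {c a : K} (hc : c ≠ 0) : v (a / c) = 0 ↔ v a = v c := by
  have := v.mul_eq_mul_iff (a := a / c) (b := 1) hc
  rw [mul_one, mul_div_cancel₀ _ hc, v.map_one] at this
  exact this.symm

theorem AddValuation.map_sub_of_lt_left {x y : K} (h : v x < v y) : v (x - y) = v x := by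
  rw [v.map_sub_swap]
  exact v.map_sub_eq_of_lt_right h

theorem AddValuation.sub_trans_le {x y z : K} {γ : WithTop Γ} (h : γ ≤ v (x - y))
    (h' : γ ≤ v (y - z)) : γ ≤ v (x - z) := by
  rw [← sub_add_sub_cancel x y z]
  exact v.map_le_add h h'

theorem AddValuation.sub_trans_lt {x y z : K} {γ : WithTop Γ} (h : γ < v (x - y))
    (h' : γ < v (y - z)) : γ < v (x - z) := by
  rw [← sub_add_sub_cancel x y z]
  exact v.map_lt_add h h'

theorem AddValuation.eq_of_lt_sub {x y : K} (h : v y < v (x - y)) : v x = v y :=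
  v.map_eq_of_lt_sub h

variable (hv : Function.Surjective v)
include hv

/-- Replacing a radius in $\Gamma$ by a field element of that valuation turns "near infinity" into a
quantifier over $K$, hence into a definable condition. -/
theorem eventually_infFilter_iff {P : K → Prop} :
    (∀ᶠ x in infFilter v, P x) ↔ ∃ g ≠ 0, ∀ x, v x < v g → P x := by
  rw [eventually_infFilter]
  constructor
  · rintro ⟨γ, h⟩
    obtain ⟨g, hg⟩ := hv γ
    exact ⟨g, fun h => by simp [h] at hg, fun x hx => h x (hg ▸ hx)⟩
  · rintro ⟨g, hg, h⟩
    obtain ⟨γ, hγ⟩ := v.exists_coe hg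
    exact ⟨γ, fun x hx => h x (hγ ▸ hx)⟩

end Valued

/-! ### Tame sets -/

section Tame

variable {K : Type uK} [Field K] {Γ : Type uG} [AddCommGroup Γ] [LinearOrder Γ]
  [IsOrderedAddMonoid Γ] (v : AddValuation K (WithTop Γ))

/-- Membership in `S` only depends on the position of a point with respect to the balls whose
centres and radii are listed in `l`. -/
def Tame (l : List (K × K)) (S : Set K) : Prop :=
  ∀ x y, (∀ q ∈ l, (v q.2 ≤ v (x - q.1) ↔ v q.2 ≤ v (y - q.1)) ∧
    (v (x - q.1) ≤ v q.2 ↔ v (y - q.1) ≤ v q.2)) → (x ∈ S ↔ y ∈ S)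

variable {v}

theorem Tame.mem_iff_of_forall_eq {l : List (K × K)} {S : Set K} (h : Tame v l S) {x y : K}
    (hxy : ∀ q ∈ l, v (x - q.1) = v (y - q.1)) : x ∈ S ↔ y ∈ S :=
  h x y fun q hq => by rw [hxy q hq]; exact ⟨Iff.rfl, Iff.rfl⟩

/-- Two integral elements whose residues differ from those of all centres are not separated by
a tame set. -/
theorem Tame.mem_iff_of_generic {l : List (K × K)} {S : Set K} (h : Tame v l S) {a b : K}
    (ha : 0 ≤ v a) (hb : 0 ≤ v b) (ha' : ∀ q ∈ l, v (a - q.1) ≤ 0) (hb' : ∀ q ∈ l, v (b - q.1) ≤ 0) :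
    a ∈ S ↔ b ∈ S := by
  refine h.mem_iff_of_forall_eq fun q hq => ?_
  rcases le_or_gt 0 (v q.1) with hc | hc
  · rw [le_antisymm (ha' q hq) (v.map_le_sub ha hc), le_antisymm (hb' q hq) (v.map_le_sub hb hc)]
  · rw [v.map_sub_eq_of_lt_right (hc.trans_le ha), v.map_sub_eq_of_lt_right (hc.trans_le hb)]

/-- Two elements whose valuations lie in an interval without centres and radii of a tame set are
not separated by it. -/
theorem Tame.mem_iff_of_no_critical {l : List (K × K)} {S : Set K} (h : Tame v l S) {a b : K}
    (hab : v a ≤ v b) (hc : ∀ q ∈ l, (v q.1 < v a ∨ v b < v q.1) ∧ (v q.2 < v a ∨ v b < v q.2)) :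
    a ∈ S ↔ b ∈ S := by
  refine h a b fun q hq => ?_
  obtain ⟨h1 | h1, h2⟩ := hc q hq
  · rw [v.map_sub_eq_of_lt_right h1, v.map_sub_eq_of_lt_right (h1.trans_le hab)]
    exact ⟨Iff.rfl, Iff.rfl⟩
  · rw [v.map_sub_of_lt_left (hab.trans_lt h1), v.map_sub_of_lt_left h1]
    rcases h2 with h2 | h2
    · exact ⟨iff_of_true h2.le (h2.le.trans hab),
        iff_of_false h2.not_ge (h2.trans_le hab).not_ge⟩
    · exact ⟨iff_of_false (hab.trans_lt h2).not_ge h2.not_ge,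
        iff_of_true (hab.trans h2.le) h2.le⟩

theorem AddValuation.list_prod_nonneg {l : List K} (h : ∀ x ∈ l, 0 ≤ v x) : 0 ≤ v l.prod := by
  induction l with
  | nil => simp
  | cons a l ih =>
    simp only [List.mem_cons, forall_eq_or_imp] at h
    rw [List.prod_cons, v.map_mul]
    exact add_nonneg h.1 (ih h.2)

theorem AddValuation.list_prod_nonpos {l : List K} (h : ∀ x ∈ l, v x ≤ 0) : v l.prod ≤ 0 := by
  induction l with
  | nil => simp
  | cons a l ih =>
    simp only [List.mem_cons, forall_eq_or_imp] at h
    rw [List.prod_cons, v.map_mul]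
    exact add_nonpos h.1 (ih h.2)

theorem AddValuation.nonpos_of_list_prod {l : List K} (h : ∀ x ∈ l, 0 ≤ v x) (h0 : v l.prod ≤ 0) :
    ∀ x ∈ l, v x ≤ 0 := by
  induction l with
  | nil => simp
  | cons a l ih =>
    simp only [List.mem_cons, forall_eq_or_imp] at h ⊢
    rw [List.prod_cons, v.map_mul] at h0
    have := v.list_prod_nonneg h.2
    exact ⟨(le_add_of_nonneg_right this).trans h0, ih h.2 ((le_add_of_nonneg_left h.1).trans h0)⟩

/-- The residue field of an algebraically closed valued field is infinite. -/
theorem AddValuation.exists_generic [IsAlgClosed K] (v : AddValuation K (WithTop Γ)) (F : List K) :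
    ∃ a, v a = 0 ∧ ∀ b ∈ F, v (a - b) ≤ 0 := by
  -- Including zero forces the element found to be a unit. Non-integral `b` can be dropped: an
  -- integral element is automatically at negative valuation distance from them.
  let F' := 0 :: F.filter fun b => 0 ≤ v b
  have hF' : ∀ b ∈ F', 0 ≤ v b := by
    intro b hb
    rcases List.mem_cons.1 hb with rfl | hb
    · simp
    · simpa using (List.mem_filter.1 hb).2
  let Q : Polynomial K := (F'.map fun b => Polynomial.X - Polynomial.C b).prod
  have hQ : Q.Monic := List.prod_induction _ (fun _ _ => Polynomial.Monic.mul) Polynomial.monic_one (by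
      rintro _ hb; obtain ⟨b, -, rfl⟩ := List.mem_map.1 hb; exact Polynomial.monic_X_sub_C b)
  have hdeg : 0 < Q.degree := by
    have h2 : Q = Polynomial.X *
        ((F.filter fun b => 0 ≤ v b).map fun b => Polynomial.X - Polynomial.C b).prod := by
      simp [Q, F']
    have h3 : (((F.filter fun b => 0 ≤ v b).map
        fun b => Polynomial.X - Polynomial.C b).prod).Monic :=
      List.prod_induction _ (fun _ _ => Polynomial.Monic.mul) Polynomial.monic_one (by
      rintro _ hb; obtain ⟨b, -, rfl⟩ := List.mem_map.1 hb; exact Polynomial.monic_X_sub_C b)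
    rw [h2, Polynomial.degree_mul, Polynomial.degree_X]
    exact add_pos_of_pos_of_nonneg one_pos (Polynomial.zero_le_degree_iff.2 h3.ne_zero)
  -- At a root of `Q - 1` the differences `a - b` multiply to `1`. Once they are known to be
  -- integral, all of them are units.
  obtain ⟨a, ha⟩ := IsAlgClosed.exists_root (Q - 1) (by
    rw [Polynomial.degree_sub_eq_left_of_degree_lt (by rwa [Polynomial.degree_one])]
    exact hdeg.ne')
  have hprod : (F'.map fun b => a - b).prod = 1 := by
    have := Polynomial.eval_list_prod (F'.map fun b => Polynomial.X - Polynomial.C b) a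
    rw [Polynomial.IsRoot, Polynomial.eval_sub, Polynomial.eval_one, sub_eq_zero, this] at ha
    simpa [Function.comp_def] using ha
  have ha0 : 0 ≤ v a := by
    by_contra! hneg
    have h1 : v ((F.filter fun b => 0 ≤ v b).map fun b => a - b).prod ≤ 0 := by
      refine v.list_prod_nonpos fun x hx => ?_
      obtain ⟨b, hb, rfl⟩ := List.mem_map.1 hx
      rw [v.map_sub_of_lt_left (hneg.trans_le (hF' b (List.mem_cons_of_mem _ hb)))]
      exact hneg.le
    have h2 := congrArg v hprod
    rw [List.map_cons, List.prod_cons, v.map_mul, v.map_one, sub_zero] at h2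
    exact (add_neg_of_neg_of_nonpos hneg h1).ne h2
  have hall := v.nonpos_of_list_prod (l := F'.map fun b => a - b) (by
    intro x hx
    obtain ⟨b, hb, rfl⟩ := List.mem_map.1 hx
    exact v.map_le_sub ha0 (hF' b hb)) (by rw [hprod, v.map_one])
  refine ⟨a, le_antisymm ?_ ha0, fun b hb => ?_⟩
  · simpa using hall (a - 0) (List.mem_map.2 ⟨0, List.mem_cons_self, rfl⟩)
  · rcases le_or_gt 0 (v b) with h | h
    · exact hall _ (List.mem_map.2 ⟨b, List.mem_cons_of_mem _ (List.mem_filter.2 ⟨hb, by simpa⟩),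
        rfl⟩)
    · rw [v.map_sub_eq_of_lt_right (h.trans_le ha0)]
      exact h.le

/-- A set meeting infinitely many residue classes contains arbitrarily long families of elements
with distinct residues. -/
theorem AddValuation.exists_distinct_residues (v : AddValuation K (WithTop Γ)) {A : K → Prop}
    (h : ∀ F : List K, ∃ a, A a ∧ ∀ b ∈ F, v (a - b) ≤ 0) (n : ℕ) :
    ∃ a : Fin n → K, (∀ i, A (a i)) ∧ ∀ i j, i ≠ j → v (a i - a j) ≤ 0 := by
  induction n with
  | zero => exact ⟨Fin.elim0, fun i => i.elim0, fun i => i.elim0⟩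
  | succ n ih =>
    obtain ⟨a, ha, haa⟩ := ih
    obtain ⟨b, hb, hba⟩ := h (List.ofFn a)
    replace hba : ∀ i, v (b - a i) ≤ 0 := fun i => hba _ (by simp)
    refine ⟨Fin.cons b a, fun i => ?_, ?_⟩
    · cases i using Fin.cases <;> simp [ha, hb]
    · refine Fin.cases (Fin.cases (by simp) fun j _ => by simpa using hba j) fun i =>
        Fin.cases (fun _ => ?_) fun j hij => ?_
      · simpa [v.map_sub_swap (a i) b] using hba i
      · simpa using haa i j (by simpa using hij)

/-- Every unit is a product of two units with generic residues. -/
theorem AddValuation.exists_generic_mul [IsAlgClosed K] (v : AddValuation K (WithTop Γ))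
    (F : List K) {c : K} (hc : v c = 0) : ∃ a b, c = a * b ∧ v a = 0 ∧ v b = 0 ∧
      (∀ x ∈ F, v (a - x) ≤ 0) ∧ ∀ x ∈ F, v (b - x) ≤ 0 := by
  -- Avoiding the quotients `c / x` keeps the cofactor `c / a` away from each `x`.
  obtain ⟨a, ha, haF⟩ := v.exists_generic (F ++ F.map fun x => c / x)
  have ha0 := v.ne_zero_of_eq ha
  have hb : v (c / a) = 0 := by rw [v.div_eq_zero_iff ha0, hc, ha]
  refine ⟨a, c / a, (mul_div_cancel₀ c ha0).symm, ha, hb, fun x hx => haF x (by simp [hx]),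
    fun x hx => ?_⟩
  by_contra! hlt
  have hx0 : v x = 0 := by
    rw [← hb]
    exact v.map_eq_of_lt_sub (by rwa [v.map_sub_swap, hb])
  refine (haF (c / x) (by simpa using Or.inr ⟨x, hx, rfl⟩)).not_gt ?_
  have hxne := v.ne_zero_of_eq hx0
  rw [show a - c / x = -((c / a - x) / x * a) by field_simp; ring, v.map_neg, v.map_mul, ha,
    add_zero, v.div_pos_iff hxne, hx0]
  exact hlt

/-- A list of few elements cannot meet all residue classes of a long family. -/
theorem AddValuation.exists_residue_avoiding {n : ℕ} {a : Fin n → K}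
    (haa : ∀ i j, i ≠ j → v (a i - a j) ≤ 0) {F : List K} {s : Finset (Fin n)}
    (hF : F.length < s.card) : ∃ i ∈ s, ∀ b ∈ F, v (a i - b) ≤ 0 := by
  classical
  by_contra! hcon
  choose! b hbF hb using hcon
  obtain ⟨i, hi, j, hj, hij, hbij⟩ := Finset.exists_ne_map_eq_of_card_lt_of_maps_to (s := s)
    (t := F.toFinset) (f := b) ((List.toFinset_card_le F).trans_lt hF)
    fun i hi => by simpa using hbF i hi
  refine (haa i j hij).not_gt ?_
  have := hb j hj
  rw [← hbij, v.map_sub_swap] at this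
  exact v.sub_trans_lt (hb i hi) this

end Tame

/-! ### Uniformly tame valued fields and definable conditions near infinity -/

section CMinimalValued

variable (L : FirstOrder.Language.{uF, uR}) {K : Type uK} [L.Structure K] [Field K]
  {Γ : Type uG} [AddCommGroup Γ] [LinearOrder Γ]
  [IsOrderedAddMonoid Γ] (v : AddValuation K (WithTop Γ))

/-- A valued field with surjective valuation in which definable families of unary sets are
uniformly tame. -/
class UniformlyTame : Prop where
  surjective : Function.Surjective v
  le : DefPred L K fun q : K × K => v q.1 ≤ v q.2
  tame : ∀ {X : Type uK} [CartesianPower K X] {P : X → K → Prop},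
    (DefPred L K fun q : X × K => P q.1 q.2) →
      ∃ N : ℕ, ∀ t, ∃ l : List (K × K), l.length ≤ N ∧ Tame v l {a | P t a}

variable {L v} [UniformlyTame L v]
  {X : Type uK} [CartesianPower K X]

namespace DefPred

variable {f g : X → K}

theorem le (hf : DefMap L K f) (hg : DefMap L K g) : DefPred L K fun x => v (f x) ≤ v (g x) :=
  UniformlyTame.le.comp (hf.prodMk hg)

theorem lt (hf : DefMap L K f) (hg : DefMap L K g) : DefPred L K fun x => v (f x) < v (g x) :=
  (le hg hf).not.congr fun _ => not_le.symm

theorem veq (hf : DefMap L K f) (hg : DefMap L K g) : DefPred L K fun x => v (f x) = v (g x) :=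
  ((le hf hg).and (le hg hf)).congr fun _ => le_antisymm_iff

theorem pos (hf : DefMap L K f) : DefPred L K fun x => 0 < v (f x) :=
  (lt (v := v) (g := f) (DefMap.const 1) hf).congr fun _ => by simp

theorem eventually {P : X → K → Prop} (hP : DefPred L K fun q : X × K => P q.1 q.2) :
    DefPred L K fun x => ∀ᶠ z in infFilter v, P x z := by
  refine congr ?_ fun x => eventually_infFilter_iff (UniformlyTame.surjective L)
  refine ex (Y := K) (and (not (eq (by fun_prop) (by fun_prop))) (all (Y := K) (imp
    (lt (by fun_prop) (by fun_prop)) ?_)))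
  exact hP.comp (f := fun q : (X × K) × K => (q.1.1, q.2)) (by fun_prop)

theorem tame {P : K → Prop} (hP : DefPred L K P) : ∃ l : List (K × K), Tame v l {a | P a} := by
  obtain ⟨N, hN⟩ := UniformlyTame.tame (L := L) (v := v) (P := fun _ : K => P)
    (hP.comp (f := fun q : K × K => q.2) (by fun_prop))
  obtain ⟨l, -, hl⟩ := hN 0
  exact ⟨l, hl⟩

/-- A definable set or its complement contains a neighborhood of infinity. -/
theorem eventually_or_eventually_not {P : K → Prop} (hP : DefPred L K P) :
    (∀ᶠ x in infFilter v, P x) ∨ ∀ᶠ x in infFilter v, ¬ P x := by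
  obtain ⟨l, hl⟩ := hP.tame (v := v)
  have hlt : ∀ c : K, ∀ᶠ x in infFilter v, v x < v c := by
    intro c
    by_cases hc : c = 0
    · filter_upwards [eventually_lt_coe 0] with x hx
      rw [hc, v.map_zero]
      exact hx.trans (WithTop.coe_lt_top _)
    · obtain ⟨γ, hγ⟩ := v.exists_coe hc
      rw [hγ]
      exact eventually_lt_coe γ
  have hev : ∀ᶠ x in infFilter v, ∀ q ∈ l, v x < v q.1 ∧ v x < v q.2 :=
    (Filter.eventually_all_finite (List.finite_toSet l)).2 fun q _ => (hlt q.1).and (hlt q.2)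
  by_cases h : ∃ x, (∀ q ∈ l, v x < v q.1 ∧ v x < v q.2) ∧ P x
  · obtain ⟨x, hx, hPx⟩ := h
    left
    filter_upwards [hev] with y hy
    rcases le_total (v x) (v y) with hxy | hxy
    · exact (hl.mem_iff_of_no_critical hxy fun q hq => ⟨.inr (hy q hq).1, .inr (hy q hq).2⟩).1 hPx
    · exact (hl.mem_iff_of_no_critical hxy fun q hq => ⟨.inr (hx q hq).1, .inr (hx q hq).2⟩).2 hPx
  · right
    filter_upwards [hev] with y hy hPy using h ⟨y, hy, hPy⟩

end DefPred

end CMinimalValued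

/-! ### Finiteness results -/

/-- In a descending chain one finds two consecutive elements whose values are not separated by a
given finite set. -/
theorem Finset.exists_step_avoiding {ι α : Type*} [LinearOrder α] (C : Finset α) (w : ι → α)
    (A : ι → Prop) (R : ι → ι → Prop) (hne : ∃ x, A x)
    (hstep : ∀ x, A x → ∃ y, A y ∧ R x y ∧ w y < w x) :
    ∃ x y, R x y ∧ w y < w x ∧ ∀ c ∈ C, c < w y ∨ w x < c := by
  classical
  -- Take `x` with the fewest points of `C` at or below its value, and descend twice. A point of `C`
  -- in the closed interval between the first two values would no longer be counted at the third;
  -- one step would not exclude the lower endpoint.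
  obtain ⟨x, hx, hmin⟩ := (measure fun x => (C.filter (· ≤ w x)).card).wf.has_min {x | A x} hne
  obtain ⟨y, hy, hxy, hlt⟩ := hstep x hx
  obtain ⟨z, hz, -, hlt'⟩ := hstep y hy
  refine ⟨x, y, hxy, hlt, fun c hc => ?_⟩
  by_contra! hcon
  have hle : (C.filter (· ≤ w x)).card ≤ (C.filter (· ≤ w z)).card := not_lt.1 (hmin z hz)
  refine hle.not_gt (Finset.card_lt_card ((Finset.ssubset_iff_of_subset fun d hd => ?_).2
    ⟨c, Finset.mem_filter.2 ⟨hc, hcon.2⟩, fun hc' => ?_⟩))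
  · simp only [Finset.mem_filter] at hd ⊢
    exact ⟨hd.1, hd.2.trans (hlt'.trans hlt).le⟩
  · exact ((Finset.mem_filter.1 hc').2.trans_lt hlt').not_ge hcon.1

section CMinimalValued

variable {L : FirstOrder.Language.{uF, uR}} {K : Type uK} [L.Structure K] [Field K]
  {Γ : Type uG} [AddCommGroup Γ] [LinearOrder Γ]
  [IsOrderedAddMonoid Γ] {v : AddValuation K (WithTop Γ)}

open Classical in
/-- The valuations of centres and radii. -/
noncomputable def criticalValues (v : AddValuation K (WithTop Γ)) (l : List (K × K)) :
    Finset (WithTop Γ) :=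
  (l.map fun q => v q.1).toFinset ∪ (l.map fun q => v q.2).toFinset

theorem Tame.mem_iff_of_criticalValues {l : List (K × K)} {S : Set K} (h : Tame v l S) {a b : K}
    (hab : v a ≤ v b) (hc : ∀ c ∈ criticalValues v l, c < v a ∨ v b < c) : a ∈ S ↔ b ∈ S :=
  h.mem_iff_of_no_critical hab fun q hq =>
    ⟨hc _ (by
        simp only [criticalValues, Finset.mem_union, List.mem_toFinset, List.mem_map]
        exact .inl ⟨q, hq, rfl⟩),
      hc _ (by
        simp only [criticalValues, Finset.mem_union, List.mem_toFinset, List.mem_map]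
        exact .inr ⟨q, hq, rfl⟩)⟩

theorem exists_eq_of_mem_criticalValues {l : List (K × K)} {c : WithTop Γ}
    (hc : c ∈ criticalValues v l) : ∃ r, c = v r := by
  simp only [criticalValues, Finset.mem_union, List.mem_toFinset, List.mem_map] at hc
  rcases hc with ⟨q, -, rfl⟩ | ⟨q, -, rfl⟩ <;> exact ⟨_, rfl⟩

theorem infFilter_neBot [Nontrivial Γ] (hv : Function.Surjective v) : (infFilter v).NeBot := by
  refine ⟨fun h => ?_⟩
  have : ∀ᶠ x in infFilter v, False := by rw [h]; exact Filter.eventually_bot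
  obtain ⟨γ, hγ⟩ := eventually_infFilter.1 this
  obtain ⟨δ, hδ⟩ := exists_lt γ
  obtain ⟨x, hx⟩ := hv δ
  exact hγ x (by rw [hx]; exact WithTop.coe_lt_coe.2 hδ)

/-- This licenses the substitution of `c * z` for `z` on which the asymptotic comparisons rest. -/
theorem eventually_mul_left {P : K → Prop} (hP : ∀ᶠ z in infFilter v, P z) {c : K} (hc : c ≠ 0) :
    ∀ᶠ z in infFilter v, P (c * z) := by
  rw [eventually_infFilter] at hP ⊢
  obtain ⟨γ, hγ⟩ := hP
  obtain ⟨δ, hδ⟩ := v.exists_coe hc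
  refine ⟨γ - δ, fun x hx => hγ _ ?_⟩
  rw [v.map_mul, hδ]
  obtain ⟨ε, hε⟩ := v.exists_coe (v.ne_zero_of_lt hx)
  rw [hε] at hx ⊢
  rw [← WithTop.coe_add, WithTop.coe_lt_coe]
  rw [WithTop.coe_lt_coe] at hx
  exact lt_sub_iff_add_lt'.1 hx

variable [UniformlyTame L v]

theorem eventually_ne_zero : ∀ᶠ z in infFilter v, z ≠ 0 := by
  filter_upwards [eventually_lt_coe 0] with z hz using v.ne_zero_of_lt hz

/-- The members of a definable family of subsets of the residue field are uniformly finite or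
cofinite. -/
theorem DefPred.residue_dichotomy {X : Type uK} [CartesianPower K X] {P : X → K → Prop}
    (hP : DefPred L K fun q : X × K => P q.1 q.2) : ∃ N : ℕ, ∀ t, ∃ F : List K, F.length ≤ N ∧
      ((∀ a, 0 ≤ v a → (∀ c ∈ F, v (a - c) ≤ 0) → P t a) ∨
        ∀ a, 0 ≤ v a → (∀ c ∈ F, v (a - c) ≤ 0) → ¬ P t a) := by
  obtain ⟨N, hN⟩ := UniformlyTame.tame (v := v) hP
  refine ⟨N, fun t => ?_⟩
  obtain ⟨l, hlN, hl⟩ := hN t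
  -- The exceptional residues are those of the centres; the radii play no role, because all generic
  -- integral points have the same distance to each centre.
  refine ⟨l.map Prod.fst, by simpa using hlN, ?_⟩
  by_contra! hcon
  obtain ⟨⟨a, ha, haF, hPa⟩, ⟨b, hb, hbF, hPb⟩⟩ := hcon
  exact hPa ((hl.mem_iff_of_generic ha hb (fun q hq => haF _ (List.mem_map.2 ⟨q, hq, rfl⟩))
    fun q hq => hbF _ (List.mem_map.2 ⟨q, hq, rfl⟩)).2 hPb)

/-- A definable set of values which is an initial segment has an endpoint. -/
theorem exists_endpoint {R : K → Prop} (hR : DefPred L K R)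
    (hdown : ∀ b b', v b ≤ v b' → R b' → R b) {b₀ b₁ : K} (h₀ : R b₀) (h₁ : ¬ R b₁)
    (hb₁ : b₁ ≠ 0) : ∃ r ≠ 0, (∀ b, v b < v r → R b) ∧ ∀ b, v r < v b → ¬ R b := by
  classical
  obtain ⟨l, hl⟩ := hR.tame (v := v)
  let C := criticalValues v l
  have hlt : ∀ b b', R b → ¬ R b' → v b < v b' := fun b b' hb hb' =>
    not_le.1 fun h => hb' (hdown _ _ h hb)
  have hR0 : ¬ R 0 := fun h => h₁ (hdown _ _ (by simp) h)
  -- Among pairs straddling the cut, take one with the fewest critical values in between. Some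
  -- critical value must lie there, and it is the endpoint: a point on the wrong side of it would
  -- give a straddling pair with fewer.
  obtain ⟨⟨c, d⟩, ⟨hc, hd, hd0⟩, hmin⟩ :=
    (measure fun q : K × K => (C.filter fun γ => v q.1 ≤ γ ∧ γ ≤ v q.2).card).wf.has_min
      {q | R q.1 ∧ ¬ R q.2 ∧ q.2 ≠ 0} ⟨(b₀, b₁), h₀, h₁, hb₁⟩
  dsimp only at hc hd hd0
  have hcd := hlt c d hc hd
  obtain ⟨γ, hγ, hcγ, hγd⟩ : ∃ γ ∈ C, v c ≤ γ ∧ γ ≤ v d := by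
    by_contra! hno
    refine hd ((hl.mem_iff_of_criticalValues hcd.le fun γ hγ => ?_).1 hc)
    exact (lt_or_ge γ (v c)).imp_right (hno γ hγ)
  obtain ⟨r, rfl⟩ := exists_eq_of_mem_criticalValues hγ
  refine ⟨r, ?_, fun b hb => ?_, fun b hb hRb => ?_⟩
  · rintro rfl
    exact v.ne_top hd0 (by simpa using hγd)
  · by_contra hRb
    refine hmin (c, b) ⟨hc, hRb, v.ne_zero_of_lt hb⟩ (Finset.card_lt_card
      ((Finset.ssubset_iff_of_subset fun γ hγ => ?_).2 ⟨v r, ?_, ?_⟩))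
    · simp only [Finset.mem_filter] at hγ ⊢
      exact ⟨hγ.1, hγ.2.1, hγ.2.2.trans (hb.le.trans hγd)⟩
    · exact Finset.mem_filter.2 ⟨hγ, hcγ, hγd⟩
    · exact fun h => (Finset.mem_filter.1 h).2.2.not_gt hb
  · refine hmin (b, d) ⟨hRb, hd, hd0⟩ (Finset.card_lt_card
      ((Finset.ssubset_iff_of_subset fun γ hγ => ?_).2 ⟨v r, ?_, ?_⟩))
    · simp only [Finset.mem_filter] at hγ ⊢
      exact ⟨hγ.1, hcγ.trans (hb.le.trans hγ.2.1), hγ.2.2⟩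
    · exact Finset.mem_filter.2 ⟨hγ, hcγ, hγd⟩
    · exact fun h => (Finset.mem_filter.1 h).2.1.not_gt hb

variable [DefinableField L K]

/-- A definable map to the residue field which only depends on the valuation has finite image. -/
theorem finite_residues_of_valuation_invariant {U : K → Prop} {Q : K → K} (hU : DefPred L K U)
    (hQ : DefMap L K Q) (hint : ∀ z, U z → 0 ≤ v (Q z))
    (hinv : ∀ z z', U z → v z = v z' → U z' ∧ 0 < v (Q z - Q z')) :
    ∃ F : List K, ∀ z, U z → ∃ c ∈ F, 0 < v (Q z - c) := by
  classical
  by_contra! hcon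
  let T : K → K → Prop := fun a z => U z ∧ 0 < v (Q z - a)
  have hT : DefPred L K fun q : K × K => T q.1 q.2 :=
    (hU.comp (by fun_prop)).and (DefPred.pos (by fun_prop))
  -- If infinitely many residues occurred, they would be linearly ordered by how far down in the
  -- value group their fibres reach. A definable linear order is incompatible with the
  -- finite–cofinite dichotomy.
  let Less : K → K → Prop := fun t a => ∃ z, T a z ∧ ∀ z', T t z' → v z < v z'
  have hLess : DefPred L K fun q : K × K => Less q.1 q.2 :=
    .ex (Y := K) (.and (.comp₂ hT (by fun_prop) (by fun_prop)) (.all (Y := K)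
      (.imp (.comp₂ hT (by fun_prop) (by fun_prop)) (.lt (by fun_prop) (by fun_prop)))))
  have htrans : ∀ a b c, Less b a → Less c b → Less c a := by
    rintro a b c ⟨z, hz, hzb⟩ ⟨y, hy, hyc⟩
    exact ⟨z, hz, fun z' hz' => (hzb y hy).trans (hyc z' hz')⟩
  have hirr : ∀ a, ¬ Less a a := fun a ⟨z, hz, h⟩ => (h z hz).false
  -- If two distinct residues were incomparable, their fibres would alternate along a strictly
  -- descending chain of values. A tame fibre can change membership only across its finitely many
  -- critical values.
  have htotal : ∀ a b, v (a - b) ≤ 0 → (∃ z, T a z) → Less a b ∨ Less b a := by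
    intro a b hab hne
    by_contra! hno
    have hdisj : ∀ z z', T a z → T b z' → v z ≠ v z' := by
      intro z z' hz hz' h
      refine hab.not_gt (v.sub_trans_lt (y := Q z) ?_ (v.sub_trans_lt (hinv z z' hz.1 h).2 hz'.2))
      rw [v.map_sub_swap]
      exact hz.2
    obtain ⟨l, hl⟩ := (DefPred.comp₂ hT (DefMap.const a) DefMap.id).tame (v := v)
    obtain ⟨x, y, hxy, hlt, hcrit⟩ := (criticalValues v l).exists_step_avoiding v
      (fun z => T a z ∨ T b z) (fun x y => ¬ (T a y ↔ T a x)) (hne.imp fun z => Or.inl) (by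
        rintro x (hx | hx)
        · have := hno.2
          simp only [Less, not_exists, not_and, not_forall, not_lt] at this
          obtain ⟨y, hy, hyx⟩ := this x hx
          exact ⟨y, .inr hy, fun h => hdisj y y (h.2 hx) hy rfl,
            hyx.lt_of_ne (hdisj x y hx hy).symm⟩
        · have := hno.1
          simp only [Less, not_exists, not_and, not_forall, not_lt] at this
          obtain ⟨y, hy, hyx⟩ := this x hx
          exact ⟨y, .inl hy, fun h => hdisj x x (h.1 hy) hx rfl,
            hyx.lt_of_ne (hdisj y x hy hx)⟩)
    exact hxy (hl.mem_iff_of_criticalValues hlt.le hcrit)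
  obtain ⟨N, hN⟩ := DefPred.residue_dichotomy (v := v) hLess
  obtain ⟨a, haT, haa⟩ := v.exists_distinct_residues (A := fun a => ∃ z, T a z) (fun F => by
    obtain ⟨z, hz, hF⟩ := hcon F
    exact ⟨Q z, ⟨z, hz, by simp⟩, hF⟩) (2 * N + 3)
  let below : Fin (2 * N + 3) → Finset (Fin (2 * N + 3)) :=
    fun i => Finset.univ.filter fun j => Less (a i) (a j)
  have hbelow : ∀ i j, j ∈ below i ↔ Less (a i) (a j) := fun i j => by simp [below]
  have hmono : ∀ i j, Less (a i) (a j) → (below j).card < (below i).card := fun i j hij =>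
    Finset.card_lt_card ((Finset.ssubset_iff_of_subset fun k hk =>
      (hbelow i k).2 (htrans _ _ _ ((hbelow j k).1 hk) hij)).2
      ⟨j, (hbelow i j).2 hij, fun h => hirr _ ((hbelow j j).1 h)⟩)
  have hcard : ∀ i, (below i).card < 2 * N + 3 := fun i => by
    have := Finset.card_lt_card (s := below i) (t := Finset.univ)
      (Finset.ssubset_univ_iff.2 fun h => hirr _ ((hbelow i i).1 (h ▸ Finset.mem_univ i)))
    simpa using this
  -- Ranks in a linear order on `2 * N + 3` elements are distinct, so some element has exactly `N +
  -- 1` predecessors and `N + 2` non-predecessors. Both numbers exceed the `N` exceptions allowed by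
  -- the dichotomy.
  obtain ⟨i, hi⟩ := (Finite.injective_iff_surjective
    (f := fun i => (⟨(below i).card, hcard i⟩ : Fin (2 * N + 3)))).1 (fun i j hij => by
      by_contra hne
      simp only [Fin.mk.injEq] at hij
      rcases htotal _ _ (haa i j hne) (haT i) with h | h
      · exact (hmono _ _ h).ne' hij
      · exact (hmono _ _ h).ne hij) ⟨N + 1, by omega⟩
  simp only [Fin.mk.injEq] at hi
  obtain ⟨F, hFN, hF⟩ := hN (a i)
  have hint' : ∀ j, 0 ≤ v (a j) := fun j => by
    obtain ⟨z, hz, hz'⟩ := haT j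
    have := v.map_le_sub (hint z hz) hz'.le
    rwa [sub_sub_cancel] at this
  rcases hF with hF | hF
  · obtain ⟨j, hj, hjF⟩ := v.exists_residue_avoiding haa (F := F) (s := (below i)ᶜ) (by
      rw [Finset.card_compl, Fintype.card_fin]
      omega)
    exact Finset.mem_compl.1 hj ((hbelow i j).2 (hF _ (hint' j) hjF))
  · obtain ⟨j, hj, hjF⟩ := v.exists_residue_avoiding haa (F := F) (s := below i) (by omega)
    exact hF _ (hint' j) hjF ((hbelow i j).1 hj)

end CMinimalValued

/-! ### Eventual constancy at infinity -/

section Constancy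

variable {L : FirstOrder.Language.{uF, uR}} {K : Type uK} [L.Structure K] [Field K]
  [IsAlgClosed K] {Γ : Type uG} [AddCommGroup Γ] [LinearOrder Γ]
  [IsOrderedAddMonoid Γ] {v : AddValuation K (WithTop Γ)}
  [UniformlyTame L v]

/-- A definable map from a neighborhood of infinity to the residue field is eventually constant. -/
theorem eventually_residue_const [Nontrivial Γ] {R : K → K → Prop}
    (hR : DefPred L K fun q : K × K => R q.1 q.2)
    (hex : ∀ᶠ z in infFilter v, ∃ a, 0 ≤ v a ∧ R z a)
    (hcl : ∀ z a a', R z a → 0 < v (a - a') → R z a') :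
    ∃ a, 0 ≤ v a ∧ ∀ᶠ z in infFilter v, R z a := by
  by_contra! hcon
  have hnot : ∀ a, 0 ≤ v a → ∀ᶠ z in infFilter v, ¬ R z a := fun a ha =>
    (DefPred.eventually_or_eventually_not (v := v)
      (hR.comp₂ DefMap.id (DefMap.const a))).resolve_left
      (Filter.not_eventually.2 (hcon a ha))
  have hA : DefPred L K fun q : K × K => ∀ z, v z < v q.1 → ¬ R z q.2 :=
    .all (Y := K) (.imp (.lt (by fun_prop) (by fun_prop))
      (.not (.comp₂ hR (by fun_prop) (by fun_prop))))
  obtain ⟨N, hN⟩ := DefPred.residue_dichotomy (v := v)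
    (P := fun g a => ∀ z, v z < v g → ¬ R z a) hA
  obtain ⟨a, ha, haa⟩ := v.exists_distinct_residues (A := fun a => v a = 0)
    (fun F => v.exists_generic F) (N + 1)
  have hva := fun i => (ha i).ge
  -- Beyond a common `g`, `N + 1` distinct residues are avoided, so almost all residues are avoided
  -- beyond `g`. The finitely many exceptions are avoided further out, leaving no value at all.
  obtain ⟨g, hg, hga⟩ := (eventually_infFilter_iff (UniformlyTame.surjective L)).1
    (Filter.eventually_all.2 fun i => hnot (a i) (hva i))
  obtain ⟨F, hFN, hF | hF⟩ := hN g
  · have h1 : ∀ᶠ z in infFilter v, v z < v g :=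
      (eventually_infFilter_iff (UniformlyTame.surjective L)).2 ⟨g, hg, fun _ => id⟩
    have h2 : ∀ᶠ z in infFilter v, ∀ c ∈ F, 0 ≤ v c → ¬ R z c :=
      (Filter.eventually_all_finite (List.finite_toSet F)).2 fun c _ =>
        Filter.eventually_imp_distrib_left.2 fun hc => hnot c hc
    have := infFilter_neBot (v := v) (UniformlyTame.surjective L)
    obtain ⟨z, ⟨a, ha, hRa⟩, hzg, hzF⟩ := (hex.and (h1.and h2)).exists
    refine hF a ha (fun c hc => ?_) z hzg hRa
    by_contra! hac
    refine hzF c hc ?_ (hcl z a c hRa hac)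
    simpa using v.map_le_sub ha hac.le
  · obtain ⟨i, -, hi⟩ := v.exists_residue_avoiding haa (F := F) (s := Finset.univ) (by simp; omega)
    exact hF _ (hva i) hi fun z hz => hga z hz i

variable [DefinableField L K]

/-- If a definable function is eventually invariant, modulo a definable equivalence relation whose
classes are balls, under the multiplication by each unit, then it is uniformly so. -/
theorem exists_forall_unit_invariant {E : K → K → Prop}
    (hE : DefPred L K fun q : K × K => E q.1 q.2) (htrans : ∀ x y z, E x y → E y z → E x z)
    {u : K → K} (hu : DefMap L K u)
    (h : ∀ c, v c = 0 → ∀ᶠ z in infFilter v, E (u (c * z)) (u z)) :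
    ∃ g ≠ 0, ∀ z z', v z < v g → v z = v z' → E (u z') (u z) := by
  obtain ⟨N, hN⟩ := DefPred.residue_dichotomy (v := v)
    (P := fun g c => ∀ z, v z < v g → E (u (c * z)) (u z))
    (.all (Y := K) (.imp (.lt (by fun_prop) (by fun_prop))
      (.comp₂ hE (by fun_prop) (by fun_prop))))
  obtain ⟨a, ha, haa⟩ := v.exists_distinct_residues (A := fun a => v a = 0)
    (fun F => v.exists_generic F) (N + 1)
  obtain ⟨g, hg, hga⟩ := (eventually_infFilter_iff (UniformlyTame.surjective L)).1
    (Filter.eventually_all.2 fun i => h (a i) (ha i))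
  refine ⟨g, hg, fun z z' hz hzz' => ?_⟩
  obtain ⟨F, hFN, hF⟩ := hN g
  replace hF := hF.resolve_right fun hF => by
    obtain ⟨i, -, hi⟩ := v.exists_residue_avoiding haa (F := F) (s := Finset.univ) (by simp; omega)
    exact hF _ (ha i).ge hi fun z hz => hga z hz i
  have hz0 := v.ne_zero_of_lt hz
  -- Beyond `g`, invariance is known only for generic units; an arbitrary unit is reached by two
  -- generic ones.
  obtain ⟨b, c, hbc, hb, hc, hbF, hcF⟩ := v.exists_generic_mul F (c := z' / z)
    ((v.div_eq_zero_iff hz0).2 hzz'.symm)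
  have hz' : z' = b * (c * z) := by rw [← mul_assoc, ← hbc, div_mul_cancel₀ _ hz0]
  rw [hz']
  exact htrans _ _ _ (hF b hb.ge hbF (c * z) (by rwa [v.map_mul, hc, zero_add]))
    (hF c hc.ge hcF z hz)

variable [Nontrivial Γ]

/-- A definable function which, modulo a definable equivalence relation whose classes are balls,
only depends on the valuation is eventually constant. -/
theorem eventually_const_of_valuation_invariant {E : K → K → Prop}
    (hE : DefPred L K fun q : K × K => E q.1 q.2) (hrefl : ∀ x, E x x)
    (hsymm : ∀ x y, E x y → E y x) (htrans : ∀ x y z, E x y → E y z → E x z)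
    (hball : ∀ c x x', E x c → v (x - c) ≤ v (x' - c) → E x' c)
    {u : K → K} (hu : DefMap L K u) {g : K} (hg : g ≠ 0)
    (h : ∀ z z', v z < v g → v z = v z' → E (u z') (u z)) :
    ∃ a, ∀ᶠ z in infFilter v, E (u z) a := by
  have hI : DefPred L K fun y => ∃ z, v z < v g ∧ E (u z) y :=
    .ex (Y := K) (.and (.lt (by fun_prop) (by fun_prop)) (.comp₂ hE (by fun_prop) (by fun_prop)))
  obtain ⟨l, hl⟩ := hI.tame (v := v)
  -- Every class met by `u` beyond `g` will be shown to contain one of these centres. Zero only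
  -- ensures that a closest centre exists.
  let C : List K := 0 :: l.map Prod.fst
  have hcover : ∀ y, (∃ z, v z < v g ∧ E (u z) y) → ∃ c ∈ C, E y c := by
    intro y hy
    by_contra! hyC
    obtain ⟨c, hcC, hcmax⟩ := Set.exists_max_image {c | c ∈ C} (fun c => v (y - c))
      (List.finite_toSet C) ⟨0, List.mem_cons_self⟩
    have hd : y - c ≠ 0 := fun h => hyC c hcC (by rw [sub_eq_zero.1 h]; exact hrefl c)
    set d := y - c with hd_def
    -- Where `u z` is not equivalent to `c`, its class is a ball missing `c`, so it is too small to
    -- affect the residue of `(u z - c) / d`. That residue thus depends only on `v z` and takes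
    -- finitely many values.
    obtain ⟨F, hF⟩ := finite_residues_of_valuation_invariant (L := L) (v := v)
      (U := fun z => v z < v g ∧ v d ≤ v (u z - c) ∧ ¬ E (u z) c) (Q := fun z => (u z - c) / d)
      (.and (.lt (by fun_prop) (by fun_prop)) (.and (.le (by fun_prop) (by fun_prop))
        (.not (.comp₂ hE (by fun_prop) (by fun_prop))))) (by fun_prop)
      (fun z hz => (v.div_nonneg_iff hd).2 hz.2.1) (by
        rintro z z' ⟨hzg, hzd, hzE⟩ hzz'
        have hE' := h z z' hzg hzz'
        have hlt : v d < v (u z - u z') := by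
          by_contra! hle
          refine hzE (hsymm _ _ (hball (u z) (u z') c hE' ?_))
          rw [v.map_sub_swap, v.map_sub_swap c]
          exact hle.trans hzd
        refine ⟨⟨hzz' ▸ hzg, ?_, fun h' => hzE (htrans _ _ _ (hsymm _ _ hE') h')⟩, ?_⟩
        · have := v.map_le_sub hzd hlt.le
          rwa [sub_sub_sub_cancel_left] at this
        · rw [← sub_div, sub_sub_sub_cancel_right]
          exact (v.div_pos_iff hd).2 hlt)
    -- Since `c` is a closest centre to `y`, moving to `c + a * d` with `a` generic preserves all
    -- distances to centres. Tameness puts this point in the saturated image, producing a residue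
    -- outside `F`.
    obtain ⟨a, ha, haG⟩ := v.exists_generic (F ++ C.map fun c' => (c' - c) / d)
    have hval : ∀ c' ∈ C, v (c + a * d - c') = v (y - c') := by
      intro c' hc'
      set e := (c' - c) / d with he
      have h1 : c + a * d - c' = d * (a - e) := by rw [he]; field_simp; ring
      have h2 : y - c' = d * (1 - e) := by
        rw [he, mul_sub, mul_div_cancel₀ _ hd, hd_def]; ring
      have hae : v (a - e) ≤ 0 := haG e (by simpa [he] using Or.inr ⟨c', hc', rfl⟩)
      have h1e : v (1 - e) ≤ 0 := by
        have := hcmax c' hc'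
        rw [← v.map_one, ← v.mul_le_mul_iff hd, mul_one, ← h2]
        exact this
      rw [h1, h2, v.mul_eq_mul_iff hd]
      rcases le_or_gt 0 (v e) with h0 | h0
      · rw [le_antisymm hae (v.map_le_sub ha.ge h0),
          le_antisymm h1e (v.map_le_sub v.map_one.ge h0)]
      · rw [v.map_sub_eq_of_lt_right (h0.trans_le ha.ge),
          v.map_sub_eq_of_lt_right (h0.trans_le v.map_one.ge)]
    obtain ⟨z', hz'g, hz'E⟩ := (hl.mem_iff_of_forall_eq fun q hq =>
      hval q.1 (List.mem_cons_of_mem _ (List.mem_map.2 ⟨q, hq, rfl⟩))).2 hy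
    have hnE : ¬ E (c + a * d) c := fun h' => hyC c hcC (hball _ _ _ h' (hval c hcC).le)
    have hvd : v (c + a * d - c) = v d := hval c hcC
    have hclose : v d < v (u z' - (c + a * d)) := by
      by_contra! hle
      refine hnE (hsymm _ _ (hball _ _ _ hz'E ?_))
      rwa [v.map_sub_swap c, hvd]
    obtain ⟨f, hfF, hf⟩ := hF z' ⟨hz'g, by
      rw [← sub_add_sub_cancel _ (c + a * d)]
      exact v.map_le_add hclose.le hvd.ge, fun h' => hnE (htrans _ _ _ (hsymm _ _ hz'E) h')⟩
    refine (haG f (by simp [hfF])).not_gt (v.sub_trans_lt ?_ hf)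
    rw [v.map_sub_swap, show (u z' - c) / d - a = (u z' - (c + a * d)) / d by field_simp; ring]
    exact (v.div_pos_iff hd).2 hclose
  by_contra! hcon
  have hno : ∀ᶠ z in infFilter v, ∀ c ∈ C, ¬ E (u z) c :=
    (Filter.eventually_all_finite (List.finite_toSet C)).2 fun c _ =>
      (DefPred.eventually_or_eventually_not (v := v)
        (hE.comp₂ hu (DefMap.const c))).resolve_left
        (Filter.not_eventually.2 (hcon c))
  have hlt : ∀ᶠ z in infFilter v, v z < v g :=
    (eventually_infFilter_iff (UniformlyTame.surjective L)).2 ⟨g, hg, fun _ => id⟩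
  have := infFilter_neBot (v := v) (UniformlyTame.surjective L)
  obtain ⟨z, hz, hzg⟩ := (hno.and hlt).exists
  obtain ⟨c, hcC, hc⟩ := hcover (u z) ⟨z, hzg, hrefl _⟩
  exact hz c hcC hc

/-- A definable function which is eventually invariant, modulo a definable equivalence relation
whose classes are balls, under the multiplication by each unit is eventually constant. -/
theorem eventually_const_of_unit_invariant {E : K → K → Prop}
    (hE : DefPred L K fun q : K × K => E q.1 q.2) (hrefl : ∀ x, E x x)
    (hsymm : ∀ x y, E x y → E y x) (htrans : ∀ x y z, E x y → E y z → E x z)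
    (hball : ∀ c x x', E x c → v (x - c) ≤ v (x' - c) → E x' c)
    {u : K → K} (hu : DefMap L K u)
    (h : ∀ c, v c = 0 → ∀ᶠ z in infFilter v, E (u (c * z)) (u z)) :
    ∃ a, ∀ᶠ z in infFilter v, E (u z) a := by
  obtain ⟨g, hg, hgE⟩ := exists_forall_unit_invariant hE htrans hu h
  exact eventually_const_of_valuation_invariant hE hrefl hsymm htrans hball hu hg hgE

end Constancy

/-! ### Leading terms and convergence up to a given precision -/

section LeadingTerm

variable {K : Type uK} [Field K] {Γ : Type uG} [AddCommGroup Γ] [LinearOrder Γ]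
  [IsOrderedAddMonoid Γ] (v : AddValuation K (WithTop Γ))

/-- Two elements have the same image in `RV`. -/
def RVEq (x y : K) : Prop := x = y ∨ v y < v (x - y)

variable {v}

theorem RVEq.refl (x : K) : RVEq v x x := .inl rfl

theorem RVEq.val_eq {x y : K} (h : RVEq v x y) : v x = v y :=
  h.elim (fun h => h ▸ rfl) v.eq_of_lt_sub

theorem RVEq.symm {x y : K} (h : RVEq v x y) : RVEq v y x := by
  rcases h with rfl | h
  · exact .refl x
  · exact .inr (by rwa [v.map_sub_swap, v.eq_of_lt_sub h])

theorem RVEq.trans {x y z : K} (h : RVEq v x y) (h' : RVEq v y z) : RVEq v x z := by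
  rcases h with rfl | h
  · exact h'
  · have := h'.val_eq
    rcases h' with rfl | h'
    · exact .inr h
    · exact .inr (v.sub_trans_lt (this ▸ h) h')

/-- The class of a nonzero `c` is an open ball centred at `c`, and that of zero is a point. This
supplies the ball hypothesis of the constancy theorem. -/
theorem RVEq.of_le {c x x' : K} (h : RVEq v x c) (hle : v (x - c) ≤ v (x' - c)) :
    RVEq v x' c := by
  rcases h with rfl | h
  · rw [sub_self, v.map_zero, top_le_iff, v.top_iff, sub_eq_zero] at hle
    exact .inl hle
  · exact .inr (h.trans_le hle)

theorem RVEq.ne_zero {x y : K} (h : RVEq v x y) (hx : x ≠ 0) : y ≠ 0 := by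
  rintro rfl
  exact v.ne_top hx (by simpa using h.val_eq)

theorem RVEq.sub_pos {x y : K} (h : RVEq v x y) (hy : v y = 0) : 0 < v (x - y) := by
  rcases h with rfl | h
  · simp
  · rwa [hy] at h

theorem RVEq.of_sub_pos {x y : K} (h : 0 < v (x - y)) (hx : v x = 0) : RVEq v x y :=
  .symm (.inr (by rwa [hx, v.map_sub_swap]))

theorem RVEq.mul_left {x y : K} (h : RVEq v x y) (c : K) : RVEq v (c * x) (c * y) := by
  by_cases hc : c = 0
  · simp [hc, RVEq.refl]
  · rcases h with rfl | h
    · exact .refl _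
    · exact .inr (by rwa [← mul_sub, v.mul_lt_mul_iff hc])

theorem RVEq.mul {x y x' y' : K} (h : RVEq v x y) (h' : RVEq v x' y') :
    RVEq v (x * x') (y * y') := by
  have := (h.mul_left x').trans (by simpa only [mul_comm] using h'.mul_left y)
  rwa [mul_comm x x']

variable {L : FirstOrder.Language.{uF, uR}} [L.Structure K] [UniformlyTame L v]
  [DefinableField L K]

theorem DefPred.rvEq {X : Type uK} [CartesianPower K X] {f g : X → K} (hf : DefMap L K f)
    (hg : DefMap L K g) : DefPred L K fun x => RVEq v (f x) (g x) :=
  .or (.eq (by fun_prop) (by fun_prop)) (.lt (by fun_prop) (by fun_prop))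

variable [IsAlgClosed K] [Nontrivial Γ]

theorem eventually_rvEq_const {u : K → K} (hu : DefMap L K u)
    (h : ∀ c, v c = 0 → ∀ᶠ z in infFilter v, RVEq v (u (c * z)) (u z)) :
    ∃ a, ∀ᶠ z in infFilter v, RVEq v (u z) a :=
  eventually_const_of_unit_invariant (.rvEq (by fun_prop) (by fun_prop)) RVEq.refl
    (fun _ _ => RVEq.symm) (fun _ _ _ => RVEq.trans) (fun _ _ _ => RVEq.of_le) hu h

/-- The valuation of a definable function cannot decrease strictly to `0` at infinity. -/
theorem not_tendsto_zero_from_above {H : K → K} (hH : DefMap L K H)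
    (hpos : ∀ᶠ z in infFilter v, 0 < v (H z))
    (hsmall : ∀ e ≠ 0, 0 < v e → ∀ᶠ z in infFilter v, v (H z) ≤ v e) : False := by
  have hv : Function.Surjective v := UniformlyTame.surjective L
  have hbot := infFilter_neBot hv
  have hne : ∀ᶠ z in infFilter v, H z ≠ 0 := by
    obtain ⟨γ, hγ⟩ := exists_zero_lt (α := Γ)
    obtain ⟨e, he⟩ := hv γ
    have he0 : e ≠ 0 := fun h => by simp [h] at he
    filter_upwards [hsmall e he0 (by rw [he]; exact_mod_cast hγ)] with z hz h0
    rw [h0, v.map_zero, top_le_iff] at hz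
    exact v.ne_top he0 hz
  -- the valuation is eventually invariant under units
  have hval : ∀ c, v c = 0 → ∀ᶠ z in infFilter v, v (H (c * z)) = v (H z) := by
    have hUp : DefPred L K fun q : K × K => ∀ᶠ z in infFilter v, v (H z) < v (H (q.2 * z)) :=
      .eventually (.lt (by fun_prop) (by fun_prop))
    have hDown : DefPred L K fun q : K × K => ∀ᶠ z in infFilter v, v (H (q.2 * z)) < v (H z) :=
      .eventually (.lt (by fun_prop) (by fun_prop))
    obtain ⟨_, h1⟩ := hUp.residue_dichotomy (v := v)
      (P := fun _ c => ∀ᶠ z in infFilter v, v (H z) < v (H (c * z)))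
    obtain ⟨_, h2⟩ := hDown.residue_dichotomy (v := v)
      (P := fun _ c => ∀ᶠ z in infFilter v, v (H (c * z)) < v (H z))
    obtain ⟨F₁, -, h1⟩ := h1 0
    obtain ⟨F₂, -, h2⟩ := h2 0
    -- If generic units strictly raised (or strictly lowered) the valuation of `H`, applying `b` and
    -- then `a` would do so too, although `a * b = 1`.
    obtain ⟨a, b, hab, ha, hb, haF, hbF⟩ := v.exists_generic_mul (F₁ ++ F₂) (c := 1) v.map_one
    have hb0 := v.ne_zero_of_eq hb
    replace h1 := h1.resolve_left fun h => by
      obtain ⟨z, h3, h4⟩ := ((h b hb.ge fun x hx => hbF x (by simp [hx])).and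
        (eventually_mul_left (h a ha.ge fun x hx => haF x (by simp [hx])) hb0)).exists
      rw [← mul_assoc, ← hab, one_mul] at h4
      exact h3.asymm h4
    replace h2 := h2.resolve_left fun h => by
      obtain ⟨z, h3, h4⟩ := ((h b hb.ge fun x hx => hbF x (by simp [hx])).and
        (eventually_mul_left (h a ha.ge fun x hx => haF x (by simp [hx])) hb0)).exists
      rw [← mul_assoc, ← hab, one_mul] at h4
      exact h3.asymm h4
    have hgen : ∀ c, v c = 0 → (∀ x ∈ F₁ ++ F₂, v (c - x) ≤ 0) →
        ∀ᶠ z in infFilter v, v (H (c * z)) = v (H z) := by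
      intro c hc hcF
      have h3 := (DefPred.eventually_or_eventually_not (v := v) (L := L)
        (P := fun z => v (H z) < v (H (c * z))) (.lt (by fun_prop) (by fun_prop))).resolve_left
        (h1 c hc.ge fun x hx => hcF x (by simp [hx]))
      have h4 := (DefPred.eventually_or_eventually_not (v := v) (L := L)
        (P := fun z => v (H (c * z)) < v (H z)) (.lt (by fun_prop) (by fun_prop))).resolve_left
        (h2 c hc.ge fun x hx => hcF x (by simp [hx]))
      filter_upwards [h3, h4] with z h3 h4 using le_antisymm (not_lt.1 h3) (not_lt.1 h4)
    intro c hc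
    obtain ⟨a, b, rfl, ha, hb, haF, hbF⟩ := v.exists_generic_mul (F₁ ++ F₂) hc
    filter_upwards [hgen b hb hbF, eventually_mul_left (hgen a ha haF) (v.ne_zero_of_eq hb)]
      with z h3 h4
    rw [mul_assoc, h4, h3]
  -- the quotients `H (c z) / H z` have eventually constant leading terms
  have hunit : ∀ c, v c = 0 → ∃ a, ∀ᶠ z in infFilter v, RVEq v (H (c * z) / H z) a := by
    intro c hc
    have hq : ∀ᶠ z in infFilter v, v (H (c * z) / H z) = 0 := by
      filter_upwards [hval c hc, hne] with z hz hz0 using (v.div_eq_zero_iff hz0).2 hz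
    obtain ⟨a, -, ha⟩ := eventually_residue_const (L := L) (v := v)
      (R := fun z a => 0 < v (H (c * z) / H z - a)) (.pos (by fun_prop))
      (by filter_upwards [hq] with z hz using ⟨H (c * z) / H z, hz.ge, by simp⟩)
      (fun z a a' h h' => v.sub_trans_lt h h')
    refine ⟨a, ?_⟩
    filter_upwards [ha, hq] with z h1 h2 using .of_sub_pos h1 h2
  have hquot : ∀ c ≠ 0, ∃ a, v a = 0 ∧ ∀ᶠ z in infFilter v, RVEq v (H (c * z) / H z) a := by
    intro c hc
    -- For a unit `b`, the factor `H (b * z) / H z` has the same leading term at `z` and at `c * z`,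
    -- so it cancels and the quotient is unit-invariant.
    obtain ⟨a, ha⟩ := eventually_rvEq_const (L := L) (v := v) (u := fun z => H (c * z) / H z)
      (by fun_prop) fun b hb => by
        obtain ⟨a, ha⟩ := hunit b hb
        have hb0 := v.ne_zero_of_eq hb
        filter_upwards [ha, eventually_mul_left ha hc, hne, eventually_mul_left hne hc,
          eventually_mul_left hne hb0, eventually_mul_left hne (mul_ne_zero hb0 hc)]
          with z h1 h2 h3 h4 h5 h6
        have h7 := (h2.trans h1.symm).mul_left (H (c * z) / H (b * z))
        rw [mul_left_comm c b z]
        generalize H (b * (c * z)) = x₁, H (c * z) = x₂, H (b * z) = x₃, H z = x₄ at *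
        convert h7 using 1 <;> field_simp
    have ha0 : a ≠ 0 := by
      obtain ⟨z, h1, h2, h3⟩ := (ha.and (hne.and (eventually_mul_left hne hc))).exists
      exact h1.ne_zero (div_ne_zero h3 h2)
    have hva : ∀ᶠ z in infFilter v, v (H (c * z)) = v (a * H z) := by
      filter_upwards [ha, hne] with z h1 h2
      rw [v.map_mul, ← h1.val_eq, ← v.map_mul, div_mul_cancel₀ _ h2]
    -- The valuations of `H z` and `H (c * z)` differ by the constant `v a`, yet both are positive
    -- and eventually below any positive bound. So the constant is zero.
    refine ⟨a, le_antisymm ?_ ?_, ha⟩ <;> by_contra! hlt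
    · obtain ⟨z, h1, h2, h3⟩ := (hva.and (hpos.and
        (eventually_mul_left (hsmall a ha0 hlt) hc))).exists
      rw [h1] at h3
      nth_rewrite 2 [← mul_one a] at h3
      rw [v.mul_le_mul_iff ha0, v.map_one] at h3
      exact h2.not_ge h3
    · have hinv : 0 < v a⁻¹ := by
        rw [← one_div, v.div_pos_iff ha0, v.map_one]
        exact hlt
      obtain ⟨z, h1, h2, h3⟩ := (hva.and ((hsmall a⁻¹ (inv_ne_zero ha0) hinv).and
        (eventually_mul_left hpos hc))).exists
      rw [h1, ← v.map_one, ← mul_inv_cancel₀ ha0, v.mul_lt_mul_iff ha0] at h3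
      exact h3.not_ge h2
  -- these leading terms are all trivial
  obtain ⟨a, -, ha⟩ := eventually_residue_const (L := L) (v := v)
    (R := fun c a => ∀ᶠ z in infFilter v, 0 < v (H (c * z) / H z - a))
    (.eventually (.pos (by fun_prop)))
    (by
      filter_upwards [eventually_ne_zero (v := v)] with c hc
      obtain ⟨a, ha, h⟩ := hquot c hc
      exact ⟨a, ha.ge, h.mono fun z hz => hz.sub_pos ha⟩)
    (fun c a a' h h' => h.mono fun z hz => v.sub_trans_lt hz h')
  have hratio : ∀ c ≠ 0, (∀ᶠ z in infFilter v, 0 < v (H (c * z) / H z - a)) →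
      ∀ᶠ z in infFilter v, RVEq v (H (c * z) / H z) a := by
    intro c hc h
    obtain ⟨b, hb, hb'⟩ := hquot c hc
    filter_upwards [h, hb'] with z h1 h2 using .of_sub_pos h1 (h2.val_eq.trans hb)
  obtain ⟨b, hb⟩ := eventually_rvEq_const hH fun c hc => by
    have hc0 := v.ne_zero_of_eq hc
    -- For `d` far out, scaling by `d` and by `c * d` both multiply the leading term by `a`.
    -- Comparing the two shows that scaling by the unit `c` does not change it.
    obtain ⟨d, h1, h2, hd⟩ := (ha.and ((eventually_mul_left ha hc0).and
      (eventually_ne_zero (v := v)))).exists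
    filter_upwards [eventually_mul_left (hratio d hd h1) hc0,
      hratio (c * d) (mul_ne_zero hc0 hd) h2, hne, eventually_mul_left hne hc0,
      eventually_mul_left hne (mul_ne_zero hc0 hd)] with z h3 h4 h5 h6 h7
    have h8 := (h4.trans h3.symm).mul_left (H z * H (c * z) / H (c * d * z))
    rw [← mul_assoc, mul_comm d c] at h8
    generalize H (c * d * z) = x₁, H (c * z) = x₂, H z = x₃ at *
    convert h8 using 1 <;> field_simp
  obtain ⟨z₀, h1, h2, h3⟩ := (hb.and (hne.and hpos)).exists
  have hb0 := h1.ne_zero h2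
  rw [h1.val_eq] at h3
  -- The valuation of `H` is now eventually the constant `v b > 0`; a square root of `b` gives a
  -- positive bound strictly below it.
  obtain ⟨e, he⟩ := IsAlgClosed.exists_pow_nat_eq b (n := 2) two_pos
  have he0 : e ≠ 0 := by
    rintro rfl
    exact hb0 (by simpa using he.symm)
  have hve : 0 < v e := by
    by_contra! hle
    rw [← he, pow_two, v.map_mul] at h3
    exact (add_nonpos hle hle).not_gt h3
  obtain ⟨z, h4, h5⟩ := (hb.and (hsmall e he0 hve)).exists
  rw [h4.val_eq, ← he, pow_two] at h5
  nth_rewrite 3 [← mul_one e] at h5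
  rw [v.mul_le_mul_iff he0, v.map_one] at h5
  exact hve.not_ge h5

/-- A definable function which is bounded at infinity converges at infinity up to any given
precision. -/
theorem exists_eventually_le_sub {u : K → K} (hu : DefMap L K u) {b₀ : K}
    (hb₀ : ∀ᶠ z in infFilter v, v b₀ ≤ v (u z)) {b : K} (hb : b ≠ 0) :
    ∃ a, ∀ᶠ z in infFilter v, v b ≤ v (u z - a) := by
  by_contra hcon
  have hbot := infFilter_neBot (v := v) (UniformlyTame.surjective L)
  -- The attainable precisions form an initial segment with endpoint `v r`. Whether or not `v r` is
  -- itself attained, a forbidden function results.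
  obtain ⟨r, hr, hlow, hhigh⟩ := exists_endpoint (L := L) (v := v)
    (R := fun b => ∃ a, ∀ᶠ z in infFilter v, v b ≤ v (u z - a))
    (.ex (Y := K) (.eventually (.le (by fun_prop) (by fun_prop))))
    (fun b b' hbb' ⟨a, ha⟩ => ⟨a, ha.mono fun z => hbb'.trans⟩)
    ⟨0, by simpa using hb₀⟩ hcon hb
  by_cases hrR : ∃ a, ∀ᶠ z in infFilter v, v r ≤ v (u z - a)
  · obtain ⟨a, ha⟩ := hrR
    obtain ⟨a', -, ha'⟩ := eventually_residue_const (L := L) (v := v)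
      (R := fun z a' => 0 < v ((u z - a) / r - a')) (.pos (by fun_prop))
      (by filter_upwards [ha] with z hz using
        ⟨(u z - a) / r, (v.div_nonneg_iff hr).2 hz, by simp⟩)
      (fun z a a' h h' => v.sub_trans_lt h h')
    -- Subtracting the limiting residue improves on precision `v r`, but no fixed precision beyond
    -- `v r` is attained.
    refine not_tendsto_zero_from_above (L := L) (v := v) (H := fun z => (u z - a) / r - a')
      (by fun_prop) ha' fun e he hve => ?_
    have hre : v r < v (r * e) := by
      rw [← v.map_one] at hve
      simpa using (v.mul_lt_mul_iff hr).2 hve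
    have h := (DefPred.eventually_or_eventually_not (v := v) (L := L)
      (P := fun z => v (r * e) ≤ v (u z - (a + r * a'))) (.le (by fun_prop)
        (by fun_prop))).resolve_left fun h => hhigh (r * e) hre ⟨_, h⟩
    filter_upwards [h] with z hz
    rw [show u z - (a + r * a') = r * ((u z - a) / r - a') by field_simp; ring,
      v.mul_le_mul_iff hr] at hz
    exact (not_le.1 hz).le
  · by_cases hinv : ∀ c, v c = 0 → ∀ᶠ z in infFilter v, v r ≤ v (u (c * z) - u z)
    · exact hrR (eventually_const_of_unit_invariant (L := L) (v := v)
        (E := fun x y => v r ≤ v (x - y)) (.le (by fun_prop) (by fun_prop)) (by simp)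
        (fun x y h => by rwa [v.map_sub_swap]) (fun x y z => v.sub_trans_le)
        (fun c x x' h h' => h.trans h') hu hinv)
    · simp only [not_forall] at hinv
      obtain ⟨c, hc, hnot⟩ := hinv
      have hc0 := v.ne_zero_of_eq hc
      have hlt := (DefPred.eventually_or_eventually_not (v := v) (L := L)
        (P := fun z => v r ≤ v (u (c * z) - u z)) (.le (by fun_prop)
        (by fun_prop))).resolve_left hnot
      have hne : ∀ᶠ z in infFilter v, u (c * z) - u z ≠ 0 := by
        filter_upwards [hlt] with z hz using v.ne_zero_of_lt (not_le.1 hz)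
      -- The oscillation of `u` under `c` is coarser than `v r`, while every precision below `v r`
      -- is attained at both `z` and `c * z`.
      refine not_tendsto_zero_from_above (L := L) (v := v) (H := fun z => r / (u (c * z) - u z))
        (by fun_prop) ?_ fun e he hve => ?_
      · filter_upwards [hlt, hne] with z hz hz0 using (v.div_pos_iff hz0).2 (not_le.1 hz)
      · have hre : v (r / e) < v r := by
          rw [← v.map_one] at hve
          have := (v.mul_lt_mul_iff (div_ne_zero hr he)).2 hve
          rwa [mul_one, div_mul_cancel₀ _ he] at this
        obtain ⟨a, ha⟩ := hlow _ hre
        filter_upwards [ha, eventually_mul_left ha hc0, hne] with z h1 h2 h3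
        rw [v.map_sub_swap] at h1
        have h4 := (v.mul_le_mul_iff he).2 (v.sub_trans_le h2 h1)
        rw [mul_div_cancel₀ _ he] at h4
        rw [← v.mul_le_mul_iff h3, mul_div_cancel₀ _ h3, mul_comm]
        exact h4

end LeadingTerm

/-! ### The definable valued field given by a `C`-minimal expansion -/

section Expansion

variable {L : FirstOrder.Language.{uF, uR}} {K : Type uK} [L.Structure K]

theorem defMap_of_functions (f : L.Functions 2) :
    DefMap L K fun q : K × K => Language.Structure.funMap f ![q.1, q.2] := fun _ => by
  have := (f.apply₂ (Language.Term.var (Sum.inl ()) : L.Term (Unit ⊕ Unit))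
    (Language.Term.var (Sum.inr ()))).definableFun_realize (M := K)
  simp only [Language.Term.realize_functions_apply₂] at this
  exact .of_empty this

theorem defPred_of_relations (R : L.Relations 2) :
    DefPred L K fun q : K × K => Language.Structure.RelMap R ![q.1, q.2] := by
  refine Set.Definable.mono (A := ∅) (Set.empty_definable_iff.2 ⟨R.formula₂
    (Language.Term.var (Sum.inl ()) : L.Term (Unit ⊕ Unit)) (Language.Term.var (Sum.inr ())), ?_⟩)
    (empty_subset _)
  ext z
  simp only [Set.mem_ofPred_eq, Language.Formula.realize_rel₂]
  exact Iff.rfl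

variable [Field K] {Γ : Type uG} [AddCommGroup Γ] [LinearOrder Γ]
  [IsOrderedAddMonoid Γ] {v : AddValuation K (WithTop Γ)} {φ : FirstOrder.Language.LHom Ldiv L}
  (hφ : IsValuedFieldExpansion v φ)
include hφ

theorem IsValuedFieldExpansion.funMap {n : ℕ} (f : DivFunc n) (x : Fin n → K) :
    Language.Structure.funMap (φ.onFunction f) x = (divStructure v).funMap f x :=
  let _ := divStructure v
  Language.LHom.IsExpansionOn.map_onFunction (self := hφ) f x

theorem IsValuedFieldExpansion.divSub_eq (x y : K) : divSub φ K x y = x - y :=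
  hφ.funMap DivFunc.sub ![x, y]

theorem IsValuedFieldExpansion.divRel_iff (x y : K) : divRel φ K x y ↔ v x ≤ v y :=
  let _ := divStructure v
  iff_of_eq (Language.LHom.IsExpansionOn.map_onRelation (self := hφ) DivRel.div ![x, y])

theorem IsValuedFieldExpansion.definableField : DefinableField L K where
  sub := by
    convert! defMap_of_functions (K := K) (φ.onFunction DivFunc.sub) using 2 with q
    exact (hφ.funMap DivFunc.sub ![q.1, q.2]).symm
  mul := by
    convert! defMap_of_functions (K := K) (φ.onFunction DivFunc.mul) using 2 with q
    exact (hφ.funMap DivFunc.mul ![q.1, q.2]).symm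

theorem IsValuedFieldExpansion.uniformlyTame (hv : Function.Surjective v)
    (hC : IsCMinimal φ K) : UniformlyTame L v where
  surjective := hv
  le := (defPred_of_relations (K := K) (φ.onRelation DivRel.div)).congr fun q =>
    (hφ.divRel_iff q.1 q.2).symm
  tame hP := by
    obtain ⟨N, hN⟩ := hC.exists_uniform_modelTame φ hP
    refine ⟨N, fun t => ?_⟩
    obtain ⟨l, hlN, hl⟩ := hN t
    refine ⟨l, hlN, fun x y hxy => hl x y fun q hq => ?_⟩
    simp only [hφ.divSub_eq, hφ.divRel_iff]
    exact hxy q hq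

end Expansion

/-! ### Fractional powers and the map `rv` -/

section FracPow

variable {M : Type*} [CommGroupWithZero M] {p : ℕ} (hp : Function.Bijective fun x : M => x ^ p)

include hp in
theorem pow_pow_injective (m : ℕ) : Function.Injective fun x : M => x ^ p ^ m := by
  induction m with
  | zero => exact fun x y h => by simpa using h
  | succ m ih =>
    simp only [pow_succ, pow_mul]
    exact hp.injective.comp ih

/-- As raising to the power `p ^ m` is injective, this identity characterises the fractional power
and lets later arguments avoid its construction. -/
theorem fracPow_pow (x : M) (n : ℤ) (m : ℕ) : fracPow p hp x n m ^ p ^ m = x ^ n := by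
  have h : ∀ (m : ℕ) (y : M),
      ((MulEquiv.ofBijective (powMonoidHom p : M →* M) hp : MulAut M) ^ m) y = y ^ p ^ m := by
    intro m
    induction m with
    | zero => simp
    | succ m ih =>
      intro y
      rw [pow_succ', MulAut.mul_apply, ih, pow_succ, pow_mul]
      rfl
  rw [fracPow, ← h, zpow_neg, zpow_natCast, MulAut.apply_inv_self]

end FracPow

section RV

variable {K : Type uK} [Field K] {Γ : Type uG} [AddCommGroup Γ] [LinearOrder Γ]
  [IsOrderedAddMonoid Γ] (v : AddValuation K (WithTop Γ))

theorem rv_coe (x : Kˣ) : rv v x = (RVStar.mk v x : RV v) := by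
  simp [rv]

/-- The multiplicative map `rv`. -/
noncomputable def rvHom : K →*₀ RV v where
  toFun := rv v
  map_zero' := by simp [rv]
  map_one' := by
    have := rv_coe v 1
    rwa [map_one, Units.val_one] at this
  map_mul' x y := by
    by_cases hx : x = 0
    · simp [rv, hx]
    · by_cases hy : y = 0
      · simp [rv, hy]
      · have := rv_coe v (Units.mk0 x hx * Units.mk0 y hy)
        rwa [map_mul, WithZero.coe_mul, ← rv_coe, ← rv_coe] at this

theorem rvHom_apply (x : K) : rvHom v x = rv v x := rfl

variable {v}

/-- Equalities in RV become a definable relation on $K$, so all asymptotic arguments can stay in the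
field. -/
theorem rv_eq_iff {x y : K} : rv v x = rv v y ↔ RVEq v x y := by
  rw [← rvHom_apply, ← rvHom_apply]
  by_cases hy : y = 0
  · subst hy
    rw [map_zero, map_eq_zero]
    exact ⟨fun h => .inl h, fun h => h.elim id fun h => by simp at h⟩
  by_cases hx : x = 0
  · subst hx
    rw [map_zero, eq_comm, map_eq_zero]
    exact ⟨fun h => absurd h hy, fun h => by
      by_contra
      exact v.ne_top hy (by simpa using h.val_eq.symm)⟩
  rw [← div_eq_one_iff_eq ((map_ne_zero _).2 hy), ← map_div₀, rvHom_apply,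
    ← Units.val_mk0 (div_ne_zero hx hy), rv_coe, ← WithZero.coe_one, WithZero.coe_inj,
    RVStar.mk_eq_one_iff, Units.val_mk0, ← div_self hy, ← sub_div, v.div_pos_iff hy]
  exact ⟨.inr, fun h => h.elim (fun h => by simp [h, (v.ne_top hy).lt_top]) id⟩

end RV

/-! ### Slopes and leading coefficients at infinity -/

section Slope

variable {K : Type uK} [Field K] {Γ : Type uG} [AddCommGroup Γ] [LinearOrder Γ]
  [IsOrderedAddMonoid Γ] {v : AddValuation K (WithTop Γ)}

theorem AddValuation.eq_zero_of_pow {x : K} {n : ℕ} (hn : n ≠ 0) (h : v (x ^ n) = 0) :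
    v x = 0 := by
  rw [v.map_pow] at h
  rcases lt_trichotomy (v x) 0 with h' | h' | h'
  · exact absurd h (nsmul_neg h' hn).ne
  · exact h'
  · exact absurd h (nsmul_pos h' hn).ne'

theorem AddValuation.eq_of_pow_eq {x y : K} {n : ℕ} (hn : n ≠ 0) (h : v (x ^ n) = v (y ^ n)) :
    v x = v y := by
  by_cases hy : y = 0
  · rw [hy, zero_pow hn, v.map_zero, v.top_iff] at h
    rw [hy, eq_zero_of_pow_eq_zero h]
  · rw [← v.div_eq_zero_iff hy]
    refine v.eq_zero_of_pow hn ?_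
    rw [div_pow, v.div_eq_zero_iff (pow_ne_zero n hy), h]

theorem RVEq.pow {x y : K} (h : RVEq v x y) (n : ℕ) : RVEq v (x ^ n) (y ^ n) := by
  induction n with
  | zero => simpa using RVEq.refl 1
  | succ n ih => simpa only [pow_succ] using ih.mul h

theorem eventually_pow {P : K → Prop} (hP : ∀ᶠ z in infFilter v, P z) {n : ℕ} (hn : n ≠ 0) :
    ∀ᶠ z in infFilter v, P (z ^ n) := by
  obtain ⟨γ, hγ⟩ := eventually_infFilter.1 hP
  filter_upwards [eventually_lt_coe γ, eventually_lt_coe 0] with z h1 h2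
  refine hγ _ (lt_of_le_of_lt ?_ h1)
  obtain ⟨m, rfl⟩ := Nat.exists_eq_succ_of_ne_zero hn
  rw [pow_succ, v.map_mul, v.map_pow]
  exact add_le_of_nonpos_left (nsmul_nonpos h2.le m)

variable [Nontrivial Γ]

/-- The slope of a function at infinity is unique. -/
theorem slope_unique (hv : Function.Surjective v) {f : K → K} {b b' : ℕ} {a a' : ℤ} {d d' : K}
    (hd : d ≠ 0) (hd' : d' ≠ 0)
    (h : ∀ᶠ x in infFilter v, v (f x ^ b) = v (x ^ a * d))
    (h' : ∀ᶠ x in infFilter v, v (f x ^ b') = v (x ^ a' * d')) :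
    a * b' = a' * b := by
  have hbot := infFilter_neBot hv
  obtain ⟨γ, hγ⟩ := exists_ne (0 : Γ)
  obtain ⟨c, hc⟩ := hv γ
  have hc0 : c ≠ 0 := fun h => by simp [h] at hc
  -- Both expressions for $v(f^{bb'})$ agree near infinity. Comparing them at `x` and `c * x` with
  -- $v(c)\ne0$ isolates the difference of the exponents.
  have key : ∀ᶠ x in infFilter v, v (x ^ (a * b') * d ^ b') = v (x ^ (a' * b) * d' ^ b) := by
    filter_upwards [h, h'] with x h1 h2
    have h3 : v (f x ^ (b * b')) = v (x ^ (a * b') * d ^ b') := by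
      rw [pow_mul, v.map_pow, h1, ← v.map_pow, mul_pow, zpow_mul, zpow_natCast]
    have h4 : v (f x ^ (b * b')) = v (x ^ (a' * b) * d' ^ b) := by
      rw [mul_comm b, pow_mul, v.map_pow, h2, ← v.map_pow, mul_pow, zpow_mul, zpow_natCast]
    rw [← h3, h4]
  obtain ⟨x, h1, h2, h3⟩ := (key.and ((eventually_mul_left key hc0).and
    (eventually_lt_coe 0))).exists
  have hx := v.ne_zero_of_lt h3
  have hD := pow_ne_zero b hd'
  have h4 : v ((c * x) ^ (a * b') * d ^ b' / (x ^ (a * b') * d ^ b')) =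
      v ((c * x) ^ (a' * b) * d' ^ b / (x ^ (a' * b) * d' ^ b)) := by
    rw [div_eq_mul_inv, div_eq_mul_inv, v.map_mul ((c * x) ^ _ * _), v.map_mul ((c * x) ^ (a' * b) * _),
      h2, v.map_inv, v.map_inv, h1]
  rw [mul_zpow, mul_zpow, mul_assoc, mul_assoc,
    mul_div_cancel_right₀ _ (mul_ne_zero (zpow_ne_zero _ hx) (pow_ne_zero _ hd)),
    mul_div_cancel_right₀ _ (mul_ne_zero (zpow_ne_zero _ hx) hD)] at h4
  by_contra hne
  have h5 : v (c ^ (a * b' - a' * b)) = 0 := by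
    rw [zpow_sub₀ hc0, v.div_eq_zero_iff (zpow_ne_zero _ hc0), h4]
  have h6 : v (c ^ (a * b' - a' * b).natAbs) = 0 := by
    rcases Int.natAbs_eq (a * b' - a' * b) with h | h <;> rw [h] at h5
    · rwa [zpow_natCast] at h5
    · rw [zpow_neg, zpow_natCast, ← one_div, v.div_eq_zero_iff (pow_ne_zero _ hc0), v.map_one] at h5
      exact h5.symm
  have := v.eq_zero_of_pow (Int.natAbs_ne_zero.2 (sub_ne_zero.2 hne)) h6
  rw [hc] at this
  exact hγ (by exact_mod_cast this)

variable {L : FirstOrder.Language.{uF, uR}} [L.Structure K] [UniformlyTame L v]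
  [DefinableField L K] [IsAlgClosed K]

/-- The denominators of slopes at infinity are powers of the characteristic exponent. -/
theorem exists_den_eq_pow (p : ℕ) [ExpChar K p] {f : K → K} (hf : DefMap L K f) {b : ℕ} {a : ℤ}
    (hb : b ≠ 0) (hab : a.natAbs.Coprime b) {d : K} (hd : d ≠ 0)
    (h : ∀ᶠ x in infFilter v, v (f x ^ b) = v (x ^ a * d)) : ∃ m, b = p ^ m := by
  have hv : Function.Surjective v := UniformlyTame.surjective L
  have hbot := infFilter_neBot hv
  refine ⟨_, Nat.eq_prime_pow_of_unique_prime_dvd hb fun {q} hq hqb => ?_⟩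
  by_contra hqp
  have hqK : (q : K) ≠ 0 := by
    intro h0
    rcases ‹ExpChar K p› with _ | ⟨hp⟩
    · exact hq.ne_zero (by exact_mod_cast h0)
    · exact hqp ((Nat.prime_dvd_prime_iff_eq hp hq).1 ((CharP.cast_eq_zero_iff K p q).1 h0)).symm
  have : NeZero (q : K) := ⟨hqK⟩
  obtain ⟨ζ, hζ⟩ := HasEnoughRootsOfUnity.exists_primitiveRoot K q
  have hζ0 := hζ.ne_zero hq.ne_zero
  have hζa : ζ ^ a ≠ 1 := by
    rw [Ne, hζ.zpow_eq_one_iff_dvd]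
    intro hqa
    exact hq.one_lt.ne' (Nat.dvd_one.1 (hab ▸ Nat.dvd_gcd (Int.natCast_dvd.1 hqa) hqb))
  obtain ⟨d', hd'⟩ := IsAlgClosed.exists_pow_nat_eq d hq.pos
  have hd'0 : d' ≠ 0 := by
    rintro rfl
    exact hd (by rw [← hd', zero_pow hq.ne_zero])
  obtain ⟨b', rfl⟩ := hqb
  -- Substituting `z ^ q` makes the slope of the `b'`-th power integral. The result has constant
  -- valuation, but rotation by `ζ` multiplies it by $\zeta^{-a}\neq1$.
  let y : K → K := fun z => f (z ^ q) ^ b' / z ^ a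
  have hy : DefMap L K y := by fun_prop
  have hyv : ∀ᶠ z in infFilter v, v (y z) = v d' := by
    filter_upwards [eventually_pow h hq.ne_zero, eventually_ne_zero (v := v)] with z h1 hz
    refine v.eq_of_pow_eq hq.ne_zero ?_
    have hza : (z ^ a) ^ q ≠ 0 := pow_ne_zero _ (zpow_ne_zero _ hz)
    rw [hd', ← v.mul_eq_mul_iff hza, div_pow, mul_div_cancel₀ _ hza, ← pow_mul, mul_comm b', h1]
    congr 2
    rw [← zpow_natCast, ← zpow_natCast, ← zpow_mul, ← zpow_mul, mul_comm]
  have hrot : ∀ z, y (ζ * z) = y z / ζ ^ a := by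
    intro z
    simp only [y]
    rw [mul_pow, hζ.pow_eq_one, one_mul, mul_zpow, div_div, mul_comm (z ^ a)]
  obtain ⟨γ, hγ⟩ := exists_zero_lt (α := Γ)
  obtain ⟨e, he⟩ := hv γ
  have he0 : e ≠ 0 := fun h => by simp [h] at he
  have hq0 : (ζ ^ a)⁻¹ - 1 ≠ 0 := by
    rw [sub_ne_zero, Ne, inv_eq_one]
    exact hζa
  have hb0 := mul_ne_zero hd'0 hq0
  -- The required precision exceeds the valuation of `y (ζ * z) - y z`, which equals that of `d' *
  -- ((ζ ^ a)⁻¹ - 1)`; the factor `e` makes the inequality strict, even if `(ζ ^ a)⁻¹ - 1` is not a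
  -- unit.
  obtain ⟨c, hc⟩ := exists_eventually_le_sub (v := v) hy (hyv.mono fun z hz => hz.ge)
    (mul_ne_zero hb0 he0)
  obtain ⟨z, h1, h2, h3⟩ := (hc.and ((eventually_mul_left hc hζ0).and hyv)).exists
  rw [v.map_sub_swap] at h1
  have h4 := v.sub_trans_le h2 h1
  rw [hrot, show y z / ζ ^ a - y z = y z * ((ζ ^ a)⁻¹ - 1) by rw [div_eq_mul_inv]; ring,
    v.map_mul (y z), h3, ← v.map_mul] at h4
  nth_rewrite 2 [← mul_one (d' * ((ζ ^ a)⁻¹ - 1))] at h4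
  rw [v.mul_le_mul_iff hb0, he, v.map_one] at h4
  exact h4.not_gt (by exact_mod_cast hγ)

/-- A definable function with a slope at infinity has a leading coefficient. -/
theorem exists_leading_coefficient {f : K → K} (hf : DefMap L K f) {b : ℕ} (hb : b ≠ 0) {a : ℤ}
    {d : K} (hd : d ≠ 0) (h : ∀ᶠ x in infFilter v, v (f x ^ b) = v (x ^ a * d)) :
    ∃ c ≠ 0, ∀ᶠ x in infFilter v, RVEq v (f x ^ b / x ^ a) (c ^ b) := by
  have hbot := infFilter_neBot (v := v) (UniformlyTame.surjective L)
  have hv0 : ∀ᶠ x in infFilter v, v (f x ^ b / x ^ a / d) = 0 := by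
    filter_upwards [h, eventually_ne_zero (v := v)] with x h1 hx
    rw [div_div, v.div_eq_zero_iff (mul_ne_zero (zpow_ne_zero _ hx) hd), h1]
  obtain ⟨e, -, he⟩ := eventually_residue_const (L := L) (v := v)
    (R := fun x e => 0 < v (f x ^ b / x ^ a / d - e)) (.pos (by fun_prop))
    (by filter_upwards [hv0] with x hx using ⟨_, hx.ge, by simp⟩)
    (fun x e e' h h' => v.sub_trans_lt h h')
  have hrv : ∀ᶠ x in infFilter v, RVEq v (f x ^ b / x ^ a / d) e := by
    filter_upwards [hv0, he] with x h1 h2 using .of_sub_pos h2 h1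
  obtain ⟨x, h1, h2⟩ := (hrv.and hv0).exists
  have he0 := h1.ne_zero (v.ne_zero_of_eq h2)
  obtain ⟨c, hc⟩ := IsAlgClosed.exists_pow_nat_eq (d * e) (Nat.pos_of_ne_zero hb)
  refine ⟨c, ?_, ?_⟩
  · rintro rfl
    exact mul_ne_zero hd he0 (by rw [← hc, zero_pow hb])
  · filter_upwards [hrv] with x hx
    have := hx.mul_left d
    rwa [mul_div_cancel₀ _ hd, ← hc] at this

end Slope

/-! ### Families of functions with rational slopes at infinity -/

section HasSlope

variable {K : Type uK} [Field K] {Γ : Type uG} [AddCommGroup Γ] [LinearOrder Γ]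
  [IsOrderedAddMonoid Γ] {v : AddValuation K (WithTop Γ)}

variable (v) in
/-- `v (f x)` equals `r • v x` up to a constant, for all `x` near infinity. -/
def HasSlope (f : K → K) (r : ℚ) : Prop :=
  ∃ d ≠ 0, ∀ᶠ x in infFilter v, v (f x ^ r.den) = v (x ^ r.num * d)

variable (v) in
/-- `rv (f x) ^ q` equals `rv x ^ n * rv d ^ q` for all `x` near infinity. -/
def IsLeadingCoefficient (f : K → K) (n : ℤ) (q : ℕ) (d : K) : Prop :=
  ∀ᶠ x in infFilter v, RVEq v (f x ^ q / x ^ n) (d ^ q)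

theorem AddValuation.map_zpow_coe {x : K} {γ : Γ} (h : v x = γ) (n : ℤ) :
    v (x ^ n) = ((n • γ : Γ) : WithTop Γ) := by
  cases n with
  | ofNat n => simp [v.map_pow, h]
  | negSucc n =>
    rw [zpow_negSucc, v.map_inv, v.map_pow, h, negSucc_zsmul, ← WithTop.coe_nsmul]
    rfl

theorem hasSlope_of_eventually_linear (hv : Function.Surjective v) {f : K → K} {h : Γ → Γ} {r : ℚ}
    {δ α : Γ} (hf : ∀ᶠ x in infFilter v, ∃ γ : Γ, v x = γ ∧ v (f x) = h γ)
    (hh : ∀ γ < δ, r.den • (h γ - α) = r.num • γ) : HasSlope v f r := by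
  obtain ⟨d, hd⟩ := hv ((r.den • α : Γ) : WithTop Γ)
  refine ⟨d, fun h0 => WithTop.coe_ne_top (hd.symm.trans (h0 ▸ v.map_zero)), ?_⟩
  filter_upwards [hf, eventually_lt_coe δ] with x ⟨γ, h1, h2⟩ h3
  have h4 := hh γ (by rwa [h1, WithTop.coe_lt_coe] at h3)
  rw [smul_sub, sub_eq_iff_eq_add] at h4
  rw [v.map_pow, h2, v.map_mul, v.map_zpow_coe h1, hd, ← WithTop.coe_nsmul, h4, WithTop.coe_add]

theorem HasSlope.unique [Nontrivial Γ] (hv : Function.Surjective v) {f : K → K} {r r' : ℚ}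
    (h : HasSlope v f r) (h' : HasSlope v f r') : r = r' := by
  obtain ⟨d, hd, h⟩ := h
  obtain ⟨d', hd', h'⟩ := h'
  exact Rat.eq_iff_mul_eq_mul.2 (slope_unique hv hd hd' h h')

theorem IsLeadingCoefficient.rv_eq [IsAlgClosed K] {p : ℕ} [ExpChar K p] {f : K → K} {n : ℤ}
    {m : ℕ} {d : K} (h : IsLeadingCoefficient v f n (p ^ m) d) : ∀ᶠ x in infFilter v,
      rv v (f x) = fracPow p (pow_bijective_rv v p) (rv v x) n m * rv v d := by
  filter_upwards [h, eventually_ne_zero (v := v)] with x hx hx0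
  refine pow_pow_injective (pow_bijective_rv v p) m ?_
  simp only [mul_pow, fracPow_pow, ← rvHom_apply, ← map_pow, ← map_zpow₀, ← map_mul]
  rw [rvHom_apply, rvHom_apply, rv_eq_iff]
  have := hx.mul_left (x ^ n)
  rwa [mul_div_cancel₀ _ (zpow_ne_zero _ hx0)] at this

/-- Raising to the power `p` is injective on RV because `p` is the characteristic exponent. Roots
along powers of `p` are therefore unambiguous. -/
theorem RVEq.of_pow [IsAlgClosed K] {p : ℕ} [ExpChar K p] {m : ℕ} {x y : K}
    (h : RVEq v (x ^ p ^ m) (y ^ p ^ m)) : RVEq v x y := by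
  rw [← rv_eq_iff, ← rvHom_apply, ← rvHom_apply] at h ⊢
  exact pow_pow_injective (pow_bijective_rv v p) m (by simpa only [map_pow] using h)

variable {L : FirstOrder.Language.{uF, uR}} [L.Structure K] [UniformlyTame L v]
  [DefinableField L K]

theorem DefPred.hasSlope {X : Type uK} [CartesianPower K X] {F : X → K → K}
    (hF : DefMap L K fun q : X × K => F q.1 q.2) (r : ℚ) :
    DefPred L K fun t => HasSlope v (F t) r := by
  refine DefPred.ex (Y := K) (.and (.not (.eq (by fun_prop) (by fun_prop))) (.eventually
    (.veq ?_ (by fun_prop))))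
  have : DefMap L K fun q : (X × K) × K => F q.1.1 q.2 :=
    hF.comp (g := fun q : X × K => F q.1 q.2) (f := fun q : (X × K) × K => (q.1.1, q.2))
      (by fun_prop)
  fun_prop

theorem DefPred.isLeadingCoefficient {X : Type uK} [CartesianPower K X] {F : X → K → K}
    (hF : DefMap L K fun q : X × K => F q.1 q.2) (n : ℤ) (q : ℕ) {d : X → K} (hd : DefMap L K d) :
    DefPred L K fun t => IsLeadingCoefficient v (F t) n q (d t) :=
  .eventually (.rvEq (by fun_prop) (by fun_prop))

variable [IsAlgClosed K]

theorem DefMap.fracPow (p : ℕ) [ExpChar K p] (n : ℤ) (m : ℕ) :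
    DefMap L K fun x : K => fracPow p (pow_bijective_field K p) x n m := by
  refine .of_graph ((DefPred.eq (f := fun q : K × K => q.2 ^ p ^ m)
    (g := fun q : K × K => q.1 ^ n) (by fun_prop) (by fun_prop)).congr fun q => ?_)
  rw [← (pow_pow_injective (pow_bijective_field K p) m).eq_iff, fracPow_pow]

variable [Nontrivial Γ]

/-- In a definably complete field, the leading coefficient at infinity is the leading term of a
limit. -/
theorem IsLeadingCoefficient.exists_limit {p : ℕ} [ExpChar K p] (hL : IsDefinablyComplete v L)
    {f : K → K} (hf : DefMap L K f) {n : ℤ} {m : ℕ} {d : K} (hd : d ≠ 0)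
    (h : IsLeadingCoefficient v f n (p ^ m) d) :
    ∃ a, HasLimitAtInfinity v (fun x => f x / fracPow p (pow_bijective_field K p) x n m) a ∧
      RVEq v d a := by
  have hv : Function.Surjective v := UniformlyTame.surjective L
  have hbot := infFilter_neBot hv
  set G : K → K := fun x => f x / fracPow p (pow_bijective_field K p) x n m
  have hG : DefMap L K G := hf.div (DefMap.fracPow p n m)
  have hGd : ∀ᶠ x in infFilter v, RVEq v (G x) d := by
    filter_upwards [h] with x hx
    refine RVEq.of_pow (p := p) (m := m) ?_
    rwa [div_pow, fracPow_pow]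
  -- The approximations to `G` of precision `v b` exist and, by the ultrametric inequality, fill a
  -- whole closed ball; smaller radii give larger balls, so the family is nested.
  have hball : ∀ b : K, b ≠ 0 → ∃ a,
      {y | ∀ᶠ x in infFilter v, v b ≤ v (G x - y)} = {y | v b ≤ v (y - a)} := by
    intro b hb
    obtain ⟨a, ha⟩ := exists_eventually_le_sub (v := v) hG (hGd.mono fun x hx => hx.val_eq.ge) hb
    refine ⟨a, Set.ext fun y => ⟨fun hy => ?_, fun hy => ?_⟩⟩
    · obtain ⟨x, h1, h2⟩ := (hy.and ha).exists
      rw [v.map_sub_swap] at h1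
      exact v.sub_trans_le h1 h2
    · simp only [Set.mem_ofPred_eq] at hy
      rw [v.map_sub_swap] at hy
      exact ha.mono fun x hx => v.sub_trans_le hx hy
  obtain ⟨a, ha⟩ := hL 1 {t | t 0 ≠ 0} (fun t => {y | ∀ᶠ x in infFilter v, v (t 0) ≤ v (G x - y)})
    (show DefPred L K fun t : Fin 1 → K => t 0 ≠ 0 from .not (.eq (by fun_prop) (by fun_prop)))
    (show DefPred L K fun q : (Fin 1 → K) × (Fin 1 → K) =>
      q.1 0 ≠ 0 ∧ ∀ᶠ x in infFilter v, v (q.1 0) ≤ v (G x - q.2 0) from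
      .and (.not (.eq (by fun_prop) (by fun_prop)))
        (.eventually (.le (by fun_prop) (by fun_prop))))
    (fun t ht => by
      obtain ⟨a, ha⟩ := hball _ ht
      exact ⟨_, ha.symm ▸ IsBall.closed a (v (t 0))⟩)
    (fun s _ t _ => by
      rcases le_total (v (s 0)) (v (t 0)) with hst | hst
      · exact .inr fun y hy => hy.mono fun x => hst.trans
      · exact .inl fun y hy => hy.mono fun x => hst.trans)
    (fun γ => by
      obtain ⟨δ, hδ⟩ := exists_gt γ
      obtain ⟨b, hb⟩ := hv δ
      have hb0 : b ≠ 0 := fun h => by simp [h] at hb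
      obtain ⟨a, ha⟩ := hball b hb0
      exact ⟨fun _ => b, hb0, _, ha.symm ▸ IsBall.closed a (v b), by
        rw [hb]
        exact_mod_cast hδ⟩)
  have hlim : ∀ b : K, b ≠ 0 → ∀ᶠ x in infFilter v, v b ≤ v (G x - a) := fun b hb =>
    Set.mem_iInter₂.1 ha (fun _ => b) hb
  have hlt : ∀ γ : Γ, ∀ᶠ x in infFilter v, (γ : WithTop Γ) < v (G x - a) := by
    intro γ
    obtain ⟨δ, hδ⟩ := exists_gt γ
    obtain ⟨b, hb⟩ := hv δ
    filter_upwards [hlim b fun h => by simp [h] at hb] with x hx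
    exact (WithTop.coe_lt_coe.2 hδ).trans_le (hb ▸ hx)
  refine ⟨a, fun γ => eventually_infFilter.1 (hlt γ), ?_⟩
  obtain ⟨γ, hγ⟩ := v.exists_coe hd
  obtain ⟨x, h1, h2⟩ := (hGd.and (hlt γ)).exists
  rw [v.map_sub_swap, ← hγ, ← h1.val_eq] at h2
  exact (RVEq.trans (.inr h2) h1).symm

end HasSlope

/-! ### Definable families -/

section Family

variable {K : Type uK} [Field K] {L : FirstOrder.Language.{uF, uR}} [L.Structure K]
  {k : ℕ} {X : Set ((Fin k → K) × K)} {f : (Fin k → K) → K → K}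

open Classical in
/-- The extension by zero of a definable family of functions is definable. -/
theorem DefinableFamily.defMap (hf : DefinableFamily L X f) :
    DefMap L K fun q : (Fin k → K) × K => if q ∈ X then f q.1 q.2 else 0 := by
  have hg : DefPred L K fun q : ((Fin k → K) × K) × K => q.1 ∈ X ∧ q.2 = f q.1.1 q.1.2 := by
    have h : DefPred L K fun q : (Fin k → K) × (Fin 2 → K) =>
      (q.1, q.2 0) ∈ X ∧ q.2 1 = f q.1 (q.2 0) := hf
    have hmap : DefMap L K fun q : ((Fin k → K) × K) × K => ![q.1.2, q.2] :=
      DefMap.pi fun i => by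
        fin_cases i
        · exact DefMap.snd.comp DefMap.fst
        · exact DefMap.snd
    exact h.comp (f := fun q : ((Fin k → K) × K) × K => (q.1.1, ![q.1.2, q.2]))
      ((DefMap.fst.comp DefMap.fst).prodMk hmap)
  have hX : DefPred L K fun q : (Fin k → K) × K => q ∈ X :=
    (DefPred.ex (Y := K) (P := fun (q : (Fin k → K) × K) y => q ∈ X ∧ y = f q.1 q.2) hg).congr fun q => by simp
  refine .of_graph ((hg.or ((hX.comp DefMap.fst).not.and
    (DefPred.eq DefMap.snd (DefMap.const 0)))).congr fun q => ?_)
  by_cases h : q.1 ∈ X <;> simp [h]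

end Family

/-! ### The factorization theorem -/

theorem mainTheorem6
    -- a non-trivially valued algebraically closed field with value group `Γ`
    {K : Type uK} [Field K] [IsAlgClosed K]
    {Γ : Type uG} [AddCommGroup Γ] [LinearOrder Γ] [IsOrderedAddMonoid Γ] [Nontrivial Γ]
    (v : AddValuation K (WithTop Γ)) (hv : Function.Surjective v)
    -- its characteristic exponent
    (p : ℕ) [ExpChar K p]
    -- a `C`-minimal expansion
    {L : FirstOrder.Language.{uF, uR}} [L.Structure K] (φ : FirstOrder.Language.LHom Ldiv L)
    (hφ : IsValuedFieldExpansion v φ) (hC : IsCMinimal φ K)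
    -- a definable family of functions `f : X ⊆ W × K → Kˣ` defined at a neighborhood of infinity
    {k : ℕ} (W : Set (Fin k → K)) (hW : DefinableK L W)
    (X : Set ((Fin k → K) × K)) (hXW : ∀ z ∈ X, z.1 ∈ W)
    (f : (Fin k → K) → K → K) (hf : DefinableFamily L X f)
    (hf0 : ∀ w x, (w, x) ∈ X → f w x ≠ 0)
    (hfinf : ∀ w ∈ W, NearInfinity v (fun x => (w, x) ∈ X))
    -- an eventually `ℚ`-linear `Γ`-factorization `h : Y ⊆ W × Γ → Γ` of `f` at infinity
    (Y : Set ((Fin k → K) × Γ)) (hYW : ∀ z ∈ Y, z.1 ∈ W)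
    (h : (Fin k → K) → Γ → Γ) (hh : DefinableΓFamily v L Y h)
    (hfac : ∀ w ∈ W, FactorizesAtInfinity v {x | (w, x) ∈ X} (f w) {γ | (w, γ) ∈ Y} (h w))
    (hlin : EventuallyQLinearAtInfinity W Y h) :
    ∃ (l : ℕ) (P : Fin l → Set (Fin k → K)) (n m : Fin l → ℤ) (c : (Fin k → K) → RVStar v),
      -- `P` is a finite definable partition of `W`
      (∀ i, DefinableK L (P i)) ∧ (∀ i, (P i).Nonempty) ∧
      Pairwise (fun i j => Disjoint (P i) (P j)) ∧ (⋃ i, P i) = W ∧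
      DefinableRVMap v L W c ∧
      (∀ i, ∀ w ∈ P i, NearInfinity v (fun x =>
        rv v (f w x) = fracPow p (pow_bijective_rv v p) (rv v x) (n i) (m i) * (c w : RV v))) ∧
      (IsDefinablyComplete v L → (∀ g : Γ → Γ, DefinableΓFun v L g → EventuallyLinear g) →
        ∀ i, ∀ w ∈ P i, ∃ a : K,
          HasLimitAtInfinity v
            (fun x => f w x / fracPow p (pow_bijective_field K p) x (n i) (m i)) a ∧
          (c w : RV v) = rv v a) := by
  classical
  have := hφ.definableField
  have := hφ.uniformlyTame hv hC
  set F : (Fin k → K) → K → K := fun w x => if (w, x) ∈ X then f w x else 0 with hFdef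
  have hF : DefMap L K fun q : (Fin k → K) × K => F q.1 q.2 := hf.defMap
  have hFw : ∀ w, DefMap L K (F w) := fun w => hF.comp (f := fun x => (w, x)) (by fun_prop)
  have hFf : ∀ w ∈ W, ∀ᶠ x in infFilter v, F w x = f w x := fun w hw =>
    (eventually_infFilter.2 (hfinf w hw)).mono fun x hx => if_pos hx
  have hWdef : DefPred L K fun w => w ∈ W := hW
  obtain ⟨Z, hZ⟩ := hlin
  have hslope : ∀ w ∈ W, ∃ r ∈ Z, HasSlope v (F w) r := by
    intro w hw
    obtain ⟨r, hr, δ, α, hα⟩ := hZ w hw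
    obtain ⟨γ₀, hγ₀⟩ := hfac w hw
    refine ⟨r, hr, hasSlope_of_eventually_linear hv ?_ fun γ hγ => (hα γ hγ).2⟩
    filter_upwards [hFf w hw, eventually_infFilter.2 (hfinf w hw), eventually_lt_coe γ₀]
      with x h1 h2 h3
    obtain ⟨γ, -, h4, h5⟩ := hγ₀ x h2 h3
    exact ⟨γ, h4, h1 ▸ h5⟩
  -- Only slopes that occur are kept, so that the pieces are nonempty and each denominator is tested
  -- on an actual function. Uniqueness of the slope makes the pieces disjoint.
  set Z' := Z.filter fun r => ∃ w ∈ W, HasSlope v (F w) r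
  set e := Z'.equivFin.symm
  set P : Fin Z'.card → Set (Fin k → K) := fun i => {w | w ∈ W ∧ HasSlope v (F w) (e i)}
  have hPdef : ∀ i, DefPred L K fun w => w ∈ P i := fun i => hWdef.and (.hasSlope hF _)
  have hPne : ∀ i, (P i).Nonempty := fun i => (Finset.mem_filter.1 (e i).2).2
  have hPex : ∀ w ∈ W, ∃ i, w ∈ P i := by
    intro w hw
    obtain ⟨r, hr, hwr⟩ := hslope w hw
    exact ⟨e.symm ⟨r, Finset.mem_filter.2 ⟨hr, w, hw, hwr⟩⟩, hw, by simpa using hwr⟩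
  have hPeq : ∀ i j w, w ∈ P i → w ∈ P j → i = j := fun i j w hi hj =>
    e.injective (Subtype.ext (hi.2.unique hv hj.2))
  have hden : ∀ i, ∃ m, (e i : ℚ).den = p ^ m := by
    intro i
    obtain ⟨w, -, d, hd, hw⟩ := hPne i
    exact exists_den_eq_pow p (hFw w) (Rat.den_ne_zero _) (Rat.reduced _) hd hw
  choose m hm using hden
  have hcoef : ∀ w, ∃ d : Kˣ, ∀ i, w ∈ P i →
      IsLeadingCoefficient v (F w) (e i : ℚ).num (p ^ m i) d := by
    intro w
    by_cases hw : ∃ i, w ∈ P i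
    · obtain ⟨i, hi⟩ := hw
      obtain ⟨d, hd, hwd⟩ := hi.2
      obtain ⟨c, hc, hwc⟩ := exists_leading_coefficient (hFw w) (Rat.den_ne_zero _) hd hwd
      refine ⟨Units.mk0 c hc, fun j hj => ?_⟩
      obtain rfl := hPeq i j w hi hj
      rwa [hm] at hwc
    · exact ⟨1, fun i hi => absurd ⟨i, hi⟩ hw⟩
  choose d hd using hcoef
  refine ⟨Z'.card, P, fun i => (e i : ℚ).num, fun i => m i, fun w => RVStar.mk v (d w), hPdef, hPne,
    fun i j hij => Set.disjoint_left.2 fun w hi hj => hij (hPeq i j w hi hj),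
    Set.ext fun w => ⟨fun hw => ?_, fun hw => Set.mem_iUnion.2 (hPex w hw)⟩, ?_, ?_, ?_⟩
  · obtain ⟨i, hi⟩ := Set.mem_iUnion.1 hw
    exact hi.1
  · have hbot := infFilter_neBot hv
    change DefPred L K fun q : (Fin k → K) × (Fin 1 → K) =>
      ∃ c : RVStar v, rv v (q.2 0) = c ∧ q.1 ∈ W ∧ c = RVStar.mk v (d q.1)
    -- The representatives `d w` come from choice, so the graph of `c` is described intrinsically:
    -- an element lies over `w` exactly when it is a leading coefficient on the piece of `w`.
    have hdef : DefPred L K fun q : (Fin k → K) × (Fin 1 → K) => ∃ i, q.1 ∈ P i ∧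
        IsLeadingCoefficient v (F q.1) (e i : ℚ).num (p ^ m i) (q.2 0) :=
      .finite_ex fun i => .and ((hPdef i).comp DefMap.fst) (.isLeadingCoefficient
        (hF.comp (g := fun q : (Fin k → K) × K => F q.1 q.2)
          (f := fun q : ((Fin k → K) × (Fin 1 → K)) × K => (q.1.1, q.2)) (by fun_prop))
        _ _ (by fun_prop))
    refine hdef.congr fun q => ⟨?_, ?_⟩
    · rintro ⟨c, h1, h2, rfl⟩
      obtain ⟨i, hi⟩ := hPex _ h2
      refine ⟨i, hi, ?_⟩
      rw [← rv_coe, rv_eq_iff] at h1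
      filter_upwards [hd _ i hi] with x hx
      exact hx.trans (h1.symm.pow _)
    · rintro ⟨i, hi, h1⟩
      refine ⟨_, ?_, hi.1, rfl⟩
      obtain ⟨x, h2, h3⟩ := (h1.and (hd _ i hi)).exists
      rw [← rv_coe, rv_eq_iff]
      exact .of_pow (h2.symm.trans h3)
  · intro i w hw
    rw [← eventually_infFilter]
    filter_upwards [(hd w i hw).rv_eq, hFf w hw.1] with x h1 h2
    rw [← h2, h1, rv_coe]
  · intro hL _ i w hw
    obtain ⟨a, ha, hda⟩ := (hd w i hw).exists_limit hL (hFw w) (d w).ne_zero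
    refine ⟨a, fun γ => eventually_infFilter.1 ?_, by rw [← rv_coe, rv_eq_iff]; exact hda⟩
    filter_upwards [eventually_infFilter.2 (ha γ), hFf w hw.1] with x h1 h2
    rwa [h2] at h1
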